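/- Setting. Let $f,h:\mathbb R^n\to(-\infty,+\infty]$ be proper lower semicontinuous convex functions (write $\overline{\mathrm{Conv}}(\mathbb R^n)$ for the class of such functions) with $\mathrm{dom}\,h\subseteq\mathrm{dom}\,f$, and let $f'$ be a map with $f'(x)\in\partial f(x)$ for all $x\in\mathrm{dom}\,h$. Assume there are $M_f>0$ and $L_f\ge 0$ with $\|f'(x)-f'(y)\|\le 2M_f+L_f\|x-y\|$ for all $x,y\in\mathrm{dom}\,h$. Put $\phi=f+h$, assume that the set $X_*$ of minimizers of $\phi$ is nonempty, and let $\phi_*=\min\phi$. Assume that $\mathrm{dom}\,h$ has at least two points and that $\|x-y\|\le D<\infty$ for all $x,y\in\mathrm{dom}\,h$. Write $\ell_f(u;x)=f(x)+\langle f'(x),u-x\rangle$. For convex $\Phi$ let $\mu(\Phi)$ be the largest $m$ such that $\Phi-\frac m2\|\cdot\|^2$ is convex, and put $\mu=\mu(\phi)$, $\nu=\mu(h)$. Bundle update. Given $c\in\mathbb R^n$, $\lambda>0$, a model $m\le f$ in $\overline{\mathrm{Conv}}(\mathbb R^n)$ and $x=\operatorname{argmin}_u\{m(u)+h(u)+\frac1{2\lambda}\|u-c\|^2\}$,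 a function $m^+\in\overline{\mathrm{Conv}}(\mathbb R^n)$ is an admissible output of $\mathrm{BU}(c,x,m,\lambda)$ if there is a function $\bar m\le f$ with $\bar m+h\in\overline{\mathrm{Conv}}(\mathbb R^n)$, $\bar m(x)=m(x)$, $x=\operatorname{argmin}_u\{\bar m(u)+h(u)+\frac1{2\lambda}\|u-c\|^2\}$ and $\max\{\bar m(\cdot),\ell_f(\cdot;x)\}\le m^+(\cdot)\le f(\cdot)$. Method U-PB. Input: $\hat x_0\in\mathrm{dom}\,h$, $\lambda_0>0$, $\chi\in[0,1)$, $\bar\varepsilon>0$ and an integer $\overline N\ge1$. 0. Set $\lambda=\lambda_0$, $N=0$, $j=k=1$, and choose $f_1\in\overline{\mathrm{Conv}}(\mathbb R^n)$ with $\ell_f(\cdot;\hat x_0)\le f_1\le f$. 1. Compute $x_j=\operatorname{argmin}_u\{f_j(u)+h(u)+\frac1{2\lambda}\|u-\hat x_{k-1}\|^2\}$; stop if $\phi(x_j)-\phi_*\le\bar\varepsilon$. 2. Let $\bar\phi_j=\phi(x_j)+\frac{\chi}{2\lambda}\|x_j-\hat x_{k-1}\|^2$ if $N=0$, and otherwise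 let $\bar\phi_j$ be the minimum of this quantity and $\bar\phi_{j-1}$. Set $N\leftarrow N+1$ and $t_j=\bar\phi_j-\big(f_j(x_j)+h(x_j)+\frac1{2\lambda}\|x_j-\hat x_{k-1}\|^2\big)$. 3. If $t_j>(1-\chi)\bar\varepsilon/2$ and $N<\overline N$ (null update), let $f_{j+1}$ be any admissible output of $\mathrm{BU}(\hat x_{k-1},x_j,f_j,\lambda)$. If $t_j>(1-\chi)\bar\varepsilon/2$ and $N=\overline N$ (reset update), set $\lambda\leftarrow\lambda/2$. If $t_j\le(1-\chi)\bar\varepsilon/2$ (serious update), set $\hat x_k=x_j$ and $k\leftarrow k+1$. After a reset or a serious update, set $N=0$ and choose any $f_{j+1}\in\overline{\mathrm{Conv}}(\mathbb R^n)$ with $\ell_f(\cdot;\hat x_{k-1})\le f_{j+1}\le f$. 4. Set $j\leftarrow j+1$ and go to step 1. Theorem. Let $d_0=\min\{\|x-\hat x_0\|:x\in X_*\}$, $$B=8+12\log\Big(1+\frac{L_f^2D^2\overline N}{16M_f^2}\Big),\qquad U(\bar\varepsilon)=\frac{4(M_f^2+\bar\varepsilon L_f)B}{(1-\chi)^2}+\frac{\overline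 N\bar\varepsilon}{\lambda_0}.$$ Then, whatever choices are made, the total number of inner iterations (those indexed by $j$, including the one at which the method stops) performed by U-PB is at most $$\min\left\{\min\left[\frac1\chi\Big(\overline N+\frac{U(\bar\varepsilon)}{\mu\bar\varepsilon}\Big),\ \overline N+\frac{U(\bar\varepsilon)}{\nu\bar\varepsilon}\right]\log\Big(1+\frac{\mu d_0^2}{\bar\varepsilon}\Big),\ \frac{d_0^2U(\bar\varepsilon)}{\bar\varepsilon^2}\right\}+\overline N\left\lceil2\log\frac{\lambda_0U(\bar\varepsilon)}{\overline N\bar\varepsilon}\right\rceil .$$ Here, for $\mu>0$, a term in the inner minimum with $\chi=0$, respectively $\nu=0$, in its denominator is $+\infty$, and for $\mu=0$ the outer minimum is understood as $d_0^2U(\bar\varepsilon)/\bar\varepsilon^2$. -/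

import Mathlib

namespace UniversalBundle

noncomputable section

/-- `ℝⁿ` with its Euclidean inner product and norm. -/
abbrev E (n : ℕ) : Type := EuclideanSpace ℝ (Fin n)

variable {n : ℕ}

/-- Effective domain of a function with values in `(-∞, +∞]`. -/
def effDom (Φ : E n → EReal) : Set (E n) := {x | Φ x < ⊤}

/-- `Φ` never takes the value `-∞` and satisfies the convexity inequality on its domain. -/
def IsConvexFn (Φ : E n → EReal) : Prop :=
  (∀ x, Φ x ≠ ⊥) ∧
    ∀ x ∈ effDom Φ, ∀ y ∈ effDom Φ, ∀ α : ℝ, 0 ≤ α → α ≤ 1 →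
      Φ (α • x + (1 - α) • y) ≤ (α : EReal) * Φ x + ((1 - α : ℝ) : EReal) * Φ y

/-- The class of proper lower semicontinuous convex functions `ℝⁿ → (-∞, +∞]`. -/
structure IsClosedProperConvex (Φ : E n → EReal) : Prop where
  convex : IsConvexFn Φ
  proper : (effDom Φ).Nonempty
  lsc : LowerSemicontinuous Φ

/-- Intrinsic convexity parameter `μ(Φ)`: the largest `m` such that `Φ - m ‖·‖² / 2` is convex.
For convex `Φ` whose domain has at least two points the set below is nonempty, closed and bounded
above, so that the supremum is a maximum. -/
def intrinsicConvexity (Φ : E n → EReal) : ℝ :=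
  sSup {m : ℝ | IsConvexFn (fun x => Φ x - ((m / 2 * ‖x‖ ^ 2 : ℝ) : EReal))}

/-- `s ∈ ∂Φ(x)`. -/
def IsSubgradient (Φ : E n → EReal) (x s : E n) : Prop :=
  ∀ y, Φ x + ((inner ℝ s (y - x) : ℝ) : EReal) ≤ Φ y

/-- The composite objective `φ = f + h`. -/
def objective (f h : E n → EReal) : E n → EReal := fun x => f x + h x

/-- The set `X_*` of minimizers of `Φ`. -/
def minimizers (Φ : E n → EReal) : Set (E n) := {x | ∀ y, Φ x ≤ Φ y}

/-- The linearization `ℓ_f(u; x) = f(x) + ⟨f'(x), u - x⟩`. -/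
def linearization (f : E n → EReal) (f' : E n → E n) (u x : E n) : EReal :=
  f x + ((inner ℝ (f' x) (u - x) : ℝ) : EReal)

/-- The hybrid composite problem: `f`, `h` closed proper convex with `dom h ⊆ dom f`, `f'` a
subgradient oracle for `f` on `dom h` with `‖f'(x) - f'(y)‖ ≤ 2 M + L ‖x - y‖` there, and an
optimal solution of `min (f + h)` exists. -/
structure IsHybridProblem (f h : E n → EReal) (f' : E n → E n) (M L : ℝ) : Prop where
  convex_f : IsClosedProperConvex f
  convex_h : IsClosedProperConvex h
  dom_subset : effDom h ⊆ effDom f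
  oracle : ∀ x ∈ effDom h, IsSubgradient f x (f' x)
  hybrid : ∀ x ∈ effDom h, ∀ y ∈ effDom h, ‖f' x - f' y‖ ≤ 2 * M + L * ‖x - y‖
  exists_min : (minimizers (objective f h)).Nonempty

/-- The prox term `w ‖u - c‖² / (2 lam)` with weight `w`. -/
def proxTerm (w lam : ℝ) (c u : E n) : EReal := ((w / (2 * lam) * ‖u - c‖ ^ 2 : ℝ) : EReal)

/-- `x` is a minimizer of `u ↦ G(u) + ‖u - c‖² / (2 lam)`. -/
def IsProxPoint (G : E n → EReal) (c : E n) (lam : ℝ) (x : E n) : Prop :=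
  ∀ u, G x + proxTerm 1 lam c x ≤ G u + proxTerm 1 lam c u

/-- `mNew` is an admissible output of the bundle update `BU(c, x, m, lam)`. -/
def IsBundleUpdate (f h : E n → EReal) (f' : E n → E n) (c x : E n) (m : E n → EReal) (lam : ℝ)
    (mNew : E n → EReal) : Prop :=
  IsClosedProperConvex mNew ∧
    ∃ mBar : E n → EReal,
      IsClosedProperConvex (fun u => mBar u + h u) ∧
      (∀ u, mBar u ≤ f u) ∧
      mBar x = m x ∧
      IsProxPoint (fun u => mBar u + h u) c lam x ∧
      ∀ u, max (mBar u) (linearization f f' u x) ≤ mNew u ∧ mNew u ≤ f u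

/-- `m` is an admissible first model of a cycle with prox-center `c`:
`ℓ_f(·; c) ≤ m ≤ f` with `m` closed proper convex. -/
def IsInitialModel (f : E n → EReal) (f' : E n → E n) (c : E n) (m : E n → EReal) : Prop :=
  IsClosedProperConvex m ∧ ∀ u, linearization f f' u c ≤ m u ∧ m u ≤ f u

/-- The data held by the method at the start of an inner iteration `j`: prox-center `x̂_{k-1}`,
stepsize `λ`, the counter `N` of the inner iterations already made in the current cycle, the value
`φ̄_{j-1}` (irrelevant if `N = 0`) and the model `f_j`. -/
structure State (n : ℕ) where
  center : E n
  stepsize : ℝ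
  count : ℕ
  best : EReal
  model : E n → EReal

/-- The value `φ̄_j` when the iterate `x_j = x` is computed in state `s`. -/
def newBest (f h : E n → EReal) (χ : ℝ) (s : State n) (x : E n) : EReal :=
  if s.count = 0 then objective f h x + proxTerm χ s.stepsize s.center x
  else min s.best (objective f h x + proxTerm χ s.stepsize s.center x)

/-- The value `t_j = φ̄_j - ((f_j + h)(x_j) + ‖x_j - x̂_{k-1}‖² / (2 λ))`. -/
def gap (f h : E n → EReal) (χ : ℝ) (s : State n) (x : E n) : EReal :=
  newBest f h χ s x - (s.model x + h x + proxTerm 1 s.stepsize s.center x)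

/-- The state before the first iteration. -/
def IsInitial (f : E n → EReal) (f' : E n → E n) (x₀ : E n) (lam₀ : ℝ) (s : State n) : Prop :=
  s.center = x₀ ∧ s.stepsize = lam₀ ∧ s.count = 0 ∧ IsInitialModel f f' x₀ s.model

/-- The stopping test `φ(x) - φ_* ≤ ε`. -/
def Stops (f h : E n → EReal) (ε : ℝ) (x : E n) : Prop :=
  objective f h x - (⨅ y, objective f h y) ≤ (ε : EReal)

/-- Null update: the gap is too large and the cycle is not exhausted; the model is refined. -/
def IsNullUpdate (f h : E n → EReal) (f' : E n → E n) (χ ε : ℝ) (Nbar : ℕ)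
    (s : State n) (x : E n) (s' : State n) : Prop :=
  (((1 - χ) * ε / 2 : ℝ) : EReal) < gap f h χ s x ∧ s.count + 1 < Nbar ∧
    s'.center = s.center ∧ s'.stepsize = s.stepsize ∧ s'.count = s.count + 1 ∧
    s'.best = newBest f h χ s x ∧
    IsBundleUpdate f h f' s.center x s.model s.stepsize s'.model

/-- Reset update: the gap is too large and the cycle is exhausted; the stepsize is halved. -/
def IsResetUpdate (f h : E n → EReal) (f' : E n → E n) (χ ε : ℝ) (Nbar : ℕ)
    (s : State n) (x : E n) (s' : State n) : Prop :=
  (((1 - χ) * ε / 2 : ℝ) : EReal) < gap f h χ s x ∧ s.count + 1 = Nbar ∧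
    s'.center = s.center ∧ s'.stepsize = s.stepsize / 2 ∧ s'.count = 0 ∧
    IsInitialModel f f' s.center s'.model

/-- Serious update: the gap is small; the iterate becomes the new prox-center. -/
def IsSeriousUpdate (f h : E n → EReal) (f' : E n → E n) (χ ε : ℝ) (Nbar : ℕ)
    (s : State n) (x : E n) (s' : State n) : Prop :=
  gap f h χ s x ≤ (((1 - χ) * ε / 2 : ℝ) : EReal) ∧ s.count + 1 ≤ Nbar ∧
    s'.center = x ∧ s'.stepsize = s.stepsize ∧ s'.count = 0 ∧
    IsInitialModel f f' x s'.model

/-- An execution of U-PB in which (at least) the inner iterations `1, …, J` are performed: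
`s j` is the state at the start of iteration `j`, and `x j` is the iterate computed in it. None of
the iterates `x 1, …, x (J - 1)` passes the stopping test; `x J` may pass it, so that a final,
stopping iteration is counted as well. -/
structure IsExecution (f h : E n → EReal) (f' : E n → E n) (x₀ : E n) (χ lam₀ ε : ℝ) (Nbar : ℕ)
    (J : ℕ) (s : ℕ → State n) (x : ℕ → E n) : Prop where
  initial : IsInitial f f' x₀ lam₀ (s 1)
  prox : ∀ j, 1 ≤ j → j ≤ J →
    IsProxPoint (fun u => (s j).model u + h u) (s j).center (s j).stepsize (x j)
  continues : ∀ j, 1 ≤ j → j < J → ¬ Stops f h ε (x j)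
  update : ∀ j, 1 ≤ j → j < J →
    IsNullUpdate f h f' χ ε Nbar (s j) (x j) (s (j + 1)) ∨
    IsResetUpdate f h f' χ ε Nbar (s j) (x j) (s (j + 1)) ∨
    IsSeriousUpdate f h f' χ ε Nbar (s j) (x j) (s (j + 1))

/-- `B = 8 + 12 log (1 + L² D² N̄ / (16 M²))`; meaningful for `M > 0`. -/
def constB (M L D : ℝ) (Nbar : ℕ) : ℝ :=
  8 + 12 * Real.log (1 + L ^ 2 * D ^ 2 * Nbar / (16 * M ^ 2))

/-- `U(ε) = 4 (M² + ε L) B / (1 - χ)² + N̄ ε / λ₀`. -/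
def constU (M L D χ lam₀ ε : ℝ) (Nbar : ℕ) : ℝ :=
  4 * (M ^ 2 + ε * L) * constB M L D Nbar / (1 - χ) ^ 2 + Nbar * ε / lam₀

/-- The factor `min [χ⁻¹ (N̄ + U / (μ ε)), N̄ + U / (ν ε)]` for `μ > 0`, where a term whose
denominator `χ` or `ν` vanishes is `+∞`. -/
def strongFactor (χ ε μ ν U : ℝ) (Nbar : ℕ) : EReal :=
  min (if χ = 0 then ⊤ else ((1 / χ * (Nbar + U / (μ * ε)) : ℝ) : EReal))
    (if ν = 0 then ⊤ else ((Nbar + U / (ν * ε) : ℝ) : EReal))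

/-- `min {min [χ⁻¹ (N̄ + U / (μ ε)), N̄ + U / (ν ε)] log (1 + μ d² / ε), d² U / ε²}
+ N̄ ⌈2 log (λ₀ U / (N̄ ε))⌉`, where the outer minimum is its second term if `μ = 0`. -/
def iterationBound (χ lam₀ ε μ ν d U : ℝ) (Nbar : ℕ) : EReal :=
  min
    (if μ = 0 then ⊤
      else strongFactor χ ε μ ν U Nbar * ((Real.log (1 + μ * d ^ 2 / ε) : ℝ) : EReal))
    ((d ^ 2 * U / ε ^ 2 : ℝ) : EReal)
  + ((Nbar * (⌈2 * Real.log (lam₀ * U / (Nbar * ε))⌉ : ℝ) : ℝ) : EReal)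

end

end UniversalBundle

/-!
The iterations are split into cycles, a cycle being the run of iterations between two consecutive
changes of center or stepsize, and the counts of serious and of reset cycles are bounded separately.
Write `A = 4 (M² + ε L) B / (1 - χ)²`, so that `U = A + Nbar ε / lam₀`.

*Length of a cycle.* Let `t` and `t⁺` be consecutive gaps of a cycle with stepsize `lam` and `r` the
distance between the two iterates. The new model dominates the old aggregate, whose subproblem grows
quadratically around its solution, and the last linearization, whose error is at most
`2 M r + L r²`; hence `t - t⁺ ≥ r² / (2 lam)` and `t⁺ ≤ 2 M r + L r²`. Eliminating `r` shows that
`gapPotential` drops by at least `1` per null update (`gapPotential_add_one_le`). The first gap is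
bounded through the linearization at the center, and `null_count_bound` concludes that `j ≤ Nbar`
iterations with gap above `(1 - χ) ε / 2` satisfy `j + 1 ≤ lam A / ε`.

*Resets.* A reset therefore requires `Nbar + 1 ≤ lam A / ε`, which leaves fewer than
`2 log (lam₀ U / (Nbar ε))` halvings (`Progress.resets_le`); rounding up gains one more cycle, which
pays for the unfinished one.

*Serious cycles.* A serious cycle with stepsize `lam` has at most `min (Nbar, lam U / ε)`
iterations: before any reset because `Nbar ≤ lam₀ U / ε`, and later by the bound above, applied to
the cycle itself or, if it consists of one iteration, to the reset cycle with stepsize `2 lam`. At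
its end the distance `d` to a fixed minimizer changes to `d⁺` with `(1 + ρ) (d⁺)² + lam ε ≤ d²`,
where one may take `ρ = lam ν` (`serious_decrease`) or, testing the subproblem at
`(1 - χ) xs + χ y` with `y` the best iterate of the cycle, `ρ = χ lam μ / (1 + (1 - χ) lam μ)`
(`serious_decrease_of_objective`). So `d² + N ε² / U` and, for `m = ν` or `m = μ`,
`log (d² + ε / m) + N / w` do not increase, where `N` counts the iterations in serious cycles and `w` is the
factor of the logarithm in the bound.
-/

namespace UniversalBundle

variable {n : ℕ}

/-! ### Convex functions with extended values and their moduli -/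

theorem isConvexFn_iff_convexOn {Φ : E n → EReal} :
    IsConvexFn Φ ↔ (∀ x, Φ x ≠ ⊥) ∧ ConvexOn ℝ (effDom Φ) (fun x => (Φ x).toReal) := by
  have lift : (∀ x, Φ x ≠ ⊥) → ∀ x ∈ effDom Φ, Φ x = ((Φ x).toReal : EReal) := fun hb x hx =>
    (EReal.coe_toReal (ne_of_lt hx) (hb x)).symm
  constructor
  · rintro ⟨hb, hc⟩
    have key : ∀ x ∈ effDom Φ, ∀ y ∈ effDom Φ, ∀ a b : ℝ, 0 ≤ a → 0 ≤ b → a + b = 1 →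
        Φ (a • x + b • y) ≤ ((a * (Φ x).toReal + b * (Φ y).toReal : ℝ) : EReal) := by
      intro x hx y hy a b ha hb' hab
      have := hc x hx y hy a ha (by linarith)
      obtain rfl : b = 1 - a := by linarith
      rw [lift hb x hx, lift hb y hy] at this
      exact_mod_cast this
    refine ⟨hb, ?_, ?_⟩
    · intro x hx y hy a b ha hb' hab
      exact (key x hx y hy a b ha hb' hab).trans_lt (EReal.coe_lt_top _)
    · intro x hx y hy a b ha hb' hab
      have h1 := key x hx y hy a b ha hb' hab
      have h2 : a • x + b • y ∈ effDom Φ := h1.trans_lt (EReal.coe_lt_top _)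
      rw [lift hb _ h2] at h1
      exact_mod_cast h1
  · rintro ⟨hb, hs, hc⟩
    refine ⟨hb, fun x hx y hy a ha ha1 => ?_⟩
    have h2 := hs hx hy ha (sub_nonneg.2 ha1) (by ring)
    have h1 := hc hx hy ha (sub_nonneg.2 ha1) (by ring)
    rw [lift hb x hx, lift hb y hy, lift hb _ h2]
    exact_mod_cast h1

theorem effDom_sub_coe (Φ : E n → EReal) (q : E n → ℝ) :
    effDom (fun x => Φ x - (q x : EReal)) = effDom Φ := by
  ext x
  simp only [effDom, Set.mem_ofPred_eq]
  induction Φ x with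
  | bot => simp
  | top => simp
  | coe r => simp only [← EReal.coe_sub, EReal.coe_lt_top]

theorem isConvexFn_sub_sq_iff {Φ : E n → EReal} (hΦ : ∀ x, Φ x ≠ ⊥) (m : ℝ) :
    IsConvexFn (fun x => Φ x - ((m / 2 * ‖x‖ ^ 2 : ℝ) : EReal)) ↔
      StrongConvexOn (effDom Φ) m (fun x => (Φ x).toReal) := by
  rw [isConvexFn_iff_convexOn, strongConvexOn_iff_convex,
    effDom_sub_coe Φ (fun x => m / 2 * ‖x‖ ^ 2)]
  have hbot : ∀ x, Φ x - ((m / 2 * ‖x‖ ^ 2 : ℝ) : EReal) ≠ ⊥ := by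
    intro x
    have := hΦ x
    induction h : Φ x with
    | bot => exact absurd h this
    | top => rw [EReal.top_sub_coe]; exact bot_ne_top.symm
    | coe r => exact_mod_cast EReal.coe_ne_bot _
  have heq : Set.EqOn (fun x => (Φ x - ((m / 2 * ‖x‖ ^ 2 : ℝ) : EReal)).toReal)
      (fun x => (Φ x).toReal - m / 2 * ‖x‖ ^ 2) (effDom Φ) := by
    intro x hx
    simp only
    rw [EReal.toReal_sub (ne_of_lt hx) (hΦ x) (EReal.coe_ne_top _) (EReal.coe_ne_bot _),
      EReal.toReal_coe]
  constructor
  · rintro ⟨-, h⟩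
    exact h.congr heq
  · intro h
    exact ⟨hbot, h.congr heq.symm⟩

/-- On a domain with two distinct points the moduli of strong convexity form a set whose supremum
is attained: every instance of the strong convexity inequality is a closed condition on the
modulus, and the instance at a midpoint bounds the modulus from above. -/
theorem strongConvexOn_sSup {C : Set (E n)} {g : E n → ℝ} (hC : C.Nontrivial)
    (hg : ConvexOn ℝ C g) :
    BddAbove {m | StrongConvexOn C m g} ∧
      StrongConvexOn C (sSup {m | StrongConvexOn C m g}) g := by
  have hne : (0 : ℝ) ∈ {m | StrongConvexOn C m g} := by
    simpa using strongConvexOn_zero.2 hg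
  have hbdd : ∀ x ∈ C, ∀ y ∈ C, ∀ a b : ℝ, 0 ≤ a → 0 ≤ b → a + b = 1 →
      0 < a * b * (‖x - y‖ ^ 2 / 2) → ∀ m ∈ {m | StrongConvexOn C m g},
      m ≤ (a * g x + b * g y - g (a • x + b • y)) / (a * b * (‖x - y‖ ^ 2 / 2)) := by
    intro x hx y hy a b ha hb hab hpos m hm
    have := hm.2 hx hy ha hb hab
    simp only [smul_eq_mul] at this
    rw [le_div_iff₀ hpos]
    linarith
  constructor
  · obtain ⟨x, hx, y, hy, hxy⟩ := hC
    have : 0 < ‖x - y‖ := norm_pos_iff.2 (sub_ne_zero.2 hxy)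
    exact ⟨_, fun m hm => hbdd x hx y hy (1 / 2) (1 / 2) (by norm_num) (by norm_num) (by norm_num)
      (by positivity) m hm⟩
  · refine ⟨hg.1, fun x hx y hy a b ha hb hab => ?_⟩
    simp only [smul_eq_mul]
    have hnn : 0 ≤ a * b * (‖x - y‖ ^ 2 / 2) := by positivity
    rcases hnn.eq_or_lt with h0 | hpos
    · have := hg.2 hx hy ha hb hab
      simp only [smul_eq_mul] at this
      have e : a * b * (sSup {m | StrongConvexOn C m g} / 2 * ‖x - y‖ ^ 2) =
        sSup {m | StrongConvexOn C m g} * (a * b * (‖x - y‖ ^ 2 / 2)) := by ring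
      rw [e, ← h0]
      linarith
    · have h1 := csSup_le ⟨0, hne⟩ (hbdd x hx y hy a b ha hb hab hpos)
      rw [le_div_iff₀ hpos] at h1
      linarith

theorem strongConvexOn_intrinsicConvexity {Φ : E n → EReal} (hΦ : IsConvexFn Φ)
    (hdom : (effDom Φ).Nontrivial) :
    0 ≤ intrinsicConvexity Φ ∧
      StrongConvexOn (effDom Φ) (intrinsicConvexity Φ) (fun x => (Φ x).toReal) ∧
      ∀ m, StrongConvexOn (effDom Φ) m (fun x => (Φ x).toReal) → m ≤ intrinsicConvexity Φ := by
  obtain ⟨hb, hc⟩ := isConvexFn_iff_convexOn.1 hΦ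
  have he : intrinsicConvexity Φ =
      sSup {m | StrongConvexOn (effDom Φ) m (fun x => (Φ x).toReal)} := by
    unfold intrinsicConvexity
    simp only [isConvexFn_sub_sq_iff hb]
  obtain ⟨h1, h2⟩ := strongConvexOn_sSup hdom hc
  rw [he]
  exact ⟨le_csSup h1 (strongConvexOn_zero.2 hc), h2, fun m hm => le_csSup h1 hm⟩

theorem norm_sq_affine_combination (a b : ℝ) (hab : a + b = 1) (u v c : E n) :
    ‖a • u + b • v - c‖ ^ 2 = a * ‖u - c‖ ^ 2 + b * ‖v - c‖ ^ 2 - a * b * ‖u - v‖ ^ 2 := by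
  obtain rfl : b = 1 - a := by linarith
  have h1 : a • u + (1 - a) • v - c = a • (u - c) + (1 - a) • (v - c) := by module
  have h2 : u - v = (u - c) - (v - c) := by abel
  rw [h1, h2]
  generalize u - c = p
  generalize v - c = q
  rw [norm_add_sq_real, norm_sub_sq_real, norm_smul, norm_smul, inner_smul_left, inner_smul_right,
    mul_pow, mul_pow, Real.norm_eq_abs, Real.norm_eq_abs, sq_abs, sq_abs]
  simp only [RCLike.conj_to_real]
  ring

/-- Quadratic growth of a proximal subproblem around its minimizer. -/
theorem prox_growth {C : Set (E n)} {g : E n → ℝ} {κ w : ℝ} {c x u : E n}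
    (hg : StrongConvexOn C κ g) (hx : x ∈ C) (hu : u ∈ C)
    (hmin : ∀ v ∈ C, g x + w / 2 * ‖x - c‖ ^ 2 ≤ g v + w / 2 * ‖v - c‖ ^ 2) :
    g x + w / 2 * ‖x - c‖ ^ 2 + (w + κ) / 2 * ‖u - x‖ ^ 2 ≤ g u + w / 2 * ‖u - c‖ ^ 2 := by
  -- compare `x` with `α u + (1 - α) x`, divide by `α` and let `α` tend to `0`
  have key : ∀ α : ℝ, 0 < α → α ≤ 1 →
      g x + w / 2 * ‖x - c‖ ^ 2 + (1 - α) * ((w + κ) / 2 * ‖u - x‖ ^ 2) ≤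
        g u + w / 2 * ‖u - c‖ ^ 2 := by
    intro α h0 h1
    have e1 := hmin _ (hg.1 hu hx h0.le (sub_nonneg.2 h1) (by ring))
    have e2 := hg.2 hu hx h0.le (sub_nonneg.2 h1) (by ring)
    simp only [smul_eq_mul] at e2
    rw [norm_sq_affine_combination _ _ (by ring)] at e1
    have : 0 ≤ α * (g u + w / 2 * ‖u - c‖ ^ 2 -
        (g x + w / 2 * ‖x - c‖ ^ 2 + (1 - α) * ((w + κ) / 2 * ‖u - x‖ ^ 2))) := by
      nlinarith
    have := nonneg_of_mul_nonneg_right this h0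
    linarith
  have hlim : Filter.Tendsto (fun α : ℝ => g x + w / 2 * ‖x - c‖ ^ 2 +
      (1 - α) * ((w + κ) / 2 * ‖u - x‖ ^ 2)) (nhdsWithin 0 (Set.Ioi 0))
      (nhds (g x + w / 2 * ‖x - c‖ ^ 2 + (1 - 0) * ((w + κ) / 2 * ‖u - x‖ ^ 2))) :=
    (Continuous.tendsto (by fun_prop) 0).mono_left nhdsWithin_le_nhds
  have := le_of_tendsto hlim (by
    filter_upwards [Ioc_mem_nhdsGT (zero_lt_one : (0 : ℝ) < 1)] with α hα
    exact key α hα.1 hα.2)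
  linarith

/-! ### Length of a cycle, and real inequalities on rates -/

/-- Lyapunov function of the null updates of a cycle with stepsize `lam`: along a sequence of gaps
with `t ≥ t⁺ + (t⁺)² / (8 lam M² + 4 lam L t⁺)` it decreases by at least `1` per step. -/
noncomputable def gapPotential (M L lam t : ℝ) : ℝ :=
  (1 + 4 * lam * L) * Real.log t - 8 * lam * M ^ 2 / t

theorem gapPotential_mono {M L lam : ℝ} (hL : 0 ≤ L) (hlam : 0 ≤ lam) {t t' : ℝ}
    (ht : 0 < t) (htt : t ≤ t') : gapPotential M L lam t ≤ gapPotential M L lam t' := by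
  unfold gapPotential
  have h1 := Real.log_le_log ht htt
  have h2 : 8 * lam * M ^ 2 / t' ≤ 8 * lam * M ^ 2 / t :=
    div_le_div_of_nonneg_left (by positivity) ht htt
  have h3 : 0 ≤ 1 + 4 * lam * L := by positivity
  nlinarith [mul_le_mul_of_nonneg_left h1 h3]

theorem gapPotential_add_one_le {M L lam r t t' : ℝ} (hM : 0 < M) (hL : 0 ≤ L) (hlam : 0 < lam)
    (hr : 0 ≤ r) (ht : 0 < t) (h1 : t ≤ 2 * M * r + L * r ^ 2) (h2 : t + r ^ 2 / (2 * lam) ≤ t') :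
    gapPotential M L lam t + 1 ≤ gapPotential M L lam t' := by
  set a := 8 * lam * M ^ 2 with ha
  set b := 4 * lam * L with hb
  have ha0 : 0 < a := by positivity
  have hb0 : 0 ≤ b := by positivity
  have hden : 0 < a + b * t := by positivity
  -- `t² / (4 M² + 2 L t)` increases with `t` and is at most `r²` at `t = 2 M r + L r²`
  have hr2 : t ^ 2 ≤ r ^ 2 * (4 * M ^ 2 + 2 * L * t) := by
    have e1 : t * t ≤ (2 * M * r + L * r ^ 2) * t := mul_le_mul_of_nonneg_right h1 ht.le
    have hk : t * (2 * M - L * r) ≤ r * (4 * M ^ 2) := by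
      rcases le_total (2 * M - L * r) 0 with h | h
      · have : 0 ≤ r * (4 * M ^ 2) := by positivity
        nlinarith [mul_nonpos_of_nonneg_of_nonpos ht.le h]
      · have := mul_le_mul_of_nonneg_right h1 h
        have h5 : 0 ≤ L ^ 2 * r ^ 3 := by positivity
        nlinarith
    nlinarith [mul_le_mul_of_nonneg_left hk hr]
  set z := t / (a + b * t) with hz
  have hz0 : 0 < z := by positivity
  have hzr : t * (1 + z) ≤ t' := by
    have : t * z ≤ r ^ 2 / (2 * lam) := by
      rw [hz, ← mul_div_assoc, div_le_div_iff₀ hden (by positivity)]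
      nlinarith
    linarith
  refine le_trans ?_ (gapPotential_mono hL hlam.le (by positivity) hzr)
  unfold gapPotential
  rw [Real.log_mul ht.ne' (by positivity), ← ha, ← hb]
  have hlog : z / (1 + z) ≤ Real.log (1 + z) := by
    have := Real.one_sub_inv_le_log_of_pos (show 0 < 1 + z by positivity)
    have e : z / (1 + z) = 1 - (1 + z)⁻¹ := by field_simp; ring
    linarith
  have hat : a / t = 1 / z - b := by
    rw [hz]; field_simp; ring
  have e1 : a / (t * (1 + z)) = (1 / z - b) / (1 + z) := by
    rw [← hat, div_div]
  rw [e1, hat]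
  have e2 : (1 / z - b) - (1 / z - b) / (1 + z) + (1 + b) * (z / (1 + z)) = 1 := by
    field_simp; ring
  have := mul_le_mul_of_nonneg_left hlog (show 0 ≤ 1 + b by positivity)
  linarith

/-- If `lam L` is small, the prox term dominates `L r²` and the first gap is at most
`4 M² lam / (1 - χ)`; here `y = 1 - χ`, and the conclusion bounds the ratio of `t₁` to the
tolerance `y ε / 2`. -/
theorem first_gap_le_of_small {M L ε lam r t₁ y : ℝ}
    (hy : 0 < y) (hε : 0 < ε) (hlam : 0 < lam) (hsmall : lam * L ≤ y / 4)
    (ht₁ : t₁ ≤ 2 * M * r + L * r ^ 2 - y / (2 * lam) * r ^ 2) :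
    t₁ / (y * ε / 2) ≤ 8 * (lam * M ^ 2 / (ε * y ^ 2)) := by
  have hLy : L ≤ y / (4 * lam) := by
    rw [le_div_iff₀ (by positivity)]
    linarith
  have ht1 : t₁ ≤ 4 * M ^ 2 * lam / y := by
    have e : 4 * M ^ 2 * lam / y - (2 * M * r - y / (4 * lam) * r ^ 2) =
        (y / (4 * lam)) * (r - 4 * M * lam / y) ^ 2 := by field_simp; ring
    have e2 : y / (2 * lam) = 2 * (y / (4 * lam)) := by field_simp; norm_num
    have h0 : 0 ≤ (y / (4 * lam)) * (r - 4 * M * lam / y) ^ 2 := by positivity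
    have h1 := mul_le_mul_of_nonneg_right hLy (sq_nonneg r)
    rw [e2] at ht₁
    linarith
  rw [div_le_iff₀ (by positivity)]
  have : 8 * (lam * M ^ 2 / (ε * y ^ 2)) * (y * ε / 2) = 4 * M ^ 2 * lam / y := by
    field_simp; ring
  linarith

/-- If `lam L` is not small and the cycle is long, the ratio of the first gap to the tolerance is
controlled by `q = L² D² Nbar / (16 M²)`, up to a term in `g = M² / (ε L y)`. -/
theorem first_gap_le_of_large {M L D ε lam r t₁ y N : ℝ} (hM : 0 < M) (hL : 0 < L)
    (hy : 0 < y) (hε : 0 < ε) (hlam : 0 < lam) (hr : 0 ≤ r) (hrD : r ≤ D)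
    (hlarge : y / 4 ≤ lam * L) (hN : 28 * (lam * M ^ 2 / (ε * y ^ 2)) ≤ N)
    (ht₁ : t₁ ≤ 2 * M * r + L * r ^ 2 - y / (2 * lam) * r ^ 2) :
    t₁ / (y * ε / 2) ≤ 14 * (L ^ 2 * D ^ 2 * N / (16 * M ^ 2)) + M ^ 2 / (ε * L * y) := by
  have hD0 : 0 ≤ D := hr.trans hrD
  have h1 : t₁ ≤ 2 * M * D + L * D ^ 2 := by
    have h0 : 0 ≤ y / (2 * lam) * r ^ 2 := by positivity
    have h2 : r ^ 2 ≤ D ^ 2 := by gcongr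
    have h3 := mul_le_mul_of_nonneg_left h2 hL.le
    have h4 := mul_le_mul_of_nonneg_left hrD hM.le
    linarith
  have hZq : 3 * L * D ^ 2 ≤ 14 * (L ^ 2 * D ^ 2 * N / (16 * M ^ 2)) * (y * ε / 2) := by
    have e1 : 14 * (L ^ 2 * D ^ 2 * (28 * (lam * M ^ 2 / (ε * y ^ 2))) / (16 * M ^ 2)) *
        (y * ε / 2) = 49 * (lam * L) / (4 * y) * (L * D ^ 2) := by
      field_simp; ring
    have e2 : 14 * (L ^ 2 * D ^ 2 * (28 * (lam * M ^ 2 / (ε * y ^ 2))) / (16 * M ^ 2)) *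
        (y * ε / 2) ≤ 14 * (L ^ 2 * D ^ 2 * N / (16 * M ^ 2)) * (y * ε / 2) := by gcongr
    have e3 : 3 ≤ 49 * (lam * L) / (4 * y) := by
      rw [le_div_iff₀ (by positivity)]; linarith
    have e4 : 0 ≤ L * D ^ 2 := by positivity
    have e5 := mul_le_mul_of_nonneg_right e3 e4
    linarith
  rw [div_le_iff₀ (by positivity), add_mul]
  have h3 : M ^ 2 / (ε * L * y) * (y * ε / 2) = M ^ 2 / (2 * L) := by
    field_simp
  have h4 : 2 * L * D ^ 2 + M ^ 2 / (2 * L) - 2 * M * D =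
      (2 * L) * (D - M / (2 * L)) ^ 2 := by field_simp; ring
  have h5 : 0 ≤ (2 * L) * (D - M / (2 * L)) ^ 2 := by positivity
  rw [h3]; linarith

theorem log_first_gap_le {v q g : ℝ} (hv : 0 < v) (hq : 0 ≤ q) (hg : 0 < g)
    (h : v ≤ 14 * q + g) : Real.log v ≤ 3 + Real.log (1 + q) + g := by
  have h1 : v ≤ (14 * (1 + q)) * (1 + g) := by nlinarith [mul_nonneg hq hg.le]
  have h2 := Real.log_le_log hv h1
  rw [Real.log_mul (by positivity) (by positivity),
    Real.log_mul (by norm_num) (by positivity)] at h2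
  have h3 : Real.log (1 + g) ≤ g := by
    have := Real.log_le_sub_one_of_pos (show 0 < 1 + g by positivity)
    linarith
  have h4 : Real.log 14 ≤ 3 := by
    rw [Real.log_le_iff_le_exp (by norm_num)]
    have e1 : Real.exp 3 = Real.exp 1 ^ 3 := by rw [← Real.exp_nat_mul]; norm_num
    rw [e1]
    have := Real.exp_one_gt_d9
    calc (14 : ℝ) ≤ 2.7 ^ 3 := by norm_num
      _ ≤ _ := by gcongr; linarith
  linarith

/-- Bound on the number `j ≤ Nbar` of iterations of a cycle that leave the gap above
`(1 - χ) ε / 2`, where `t₁` is the first and `t` the last gap. -/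
theorem null_count_bound {M L D χ ε lam r t₁ t : ℝ} {j Nbar : ℕ} (hM : 0 < M) (hL : 0 ≤ L)
    (hχ₀ : 0 ≤ χ) (hχ₁ : χ < 1) (hε : 0 < ε) (hlam : 0 < lam)
    (hr : 0 ≤ r) (hrD : r ≤ D) (hj : j ≤ Nbar)
    (ht₁ : t₁ ≤ 2 * M * r + L * r ^ 2 - (1 - χ) / (2 * lam) * r ^ 2)
    (ht₁δ : (1 - χ) * ε / 2 < t₁) (ht : (1 - χ) * ε / 2 < t)
    (hpot : gapPotential M L lam t + j ≤ gapPotential M L lam t₁ + 1) :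
    (j : ℝ) + 1 ≤ lam * (4 * (M ^ 2 + ε * L) * constB M L D Nbar / (1 - χ) ^ 2) / ε := by
  obtain ⟨y, hy⟩ : ∃ y, y = 1 - χ := ⟨_, rfl⟩
  have hy0 : 0 < y := by linarith
  have hy1 : y ≤ 1 := by linarith
  unfold constB
  rw [← hy] at ht₁ ht₁δ ht ⊢
  have hδ0 : 0 < y * ε / 2 := by positivity
  have ht10 : 0 < t₁ := hδ0.trans ht₁δ
  have hv0 : 0 < t₁ / (y * ε / 2) := by positivity
  have hlog0 : 0 ≤ Real.log (t₁ / (y * ε / 2)) := Real.log_nonneg ((one_le_div hδ0).2 ht₁δ.le)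
  have hq0 : 0 ≤ L ^ 2 * D ^ 2 * (Nbar : ℝ) / (16 * M ^ 2) := by positivity
  have hsm := first_gap_le_of_small hy0 hε hlam (t₁ := t₁) (r := r) (M := M) (L := L)
  have hlg := fun hL : 0 < L =>
    first_gap_le_of_large hM hL hy0 hε hlam hr hrD (N := Nbar) (t₁ := t₁)
  have hll := fun g => log_first_gap_le hv0 hq0 (g := g)
  have hlogq : 0 ≤ Real.log (1 + L ^ 2 * D ^ 2 * Nbar / (16 * M ^ 2)) :=
    Real.log_nonneg (by linarith)
  have hT : lam * (4 * (M ^ 2 + ε * L) *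
      (8 + 12 * Real.log (1 + L ^ 2 * D ^ 2 * Nbar / (16 * M ^ 2))) / y ^ 2) / ε =
      (lam * M ^ 2 / (ε * y ^ 2) + lam * L / y ^ 2) *
      (32 + 48 * Real.log (1 + L ^ 2 * D ^ 2 * Nbar / (16 * M ^ 2))) := by
    field_simp; ring
  rw [hT]
  have hcount : (j : ℝ) ≤ 1 + (1 + 4 * lam * L) * Real.log (t₁ / (y * ε / 2)) +
      16 * (lam * M ^ 2 / (ε * y ^ 2)) := by
    have h1 := gapPotential_mono (M := M) hL hlam.le hδ0 ht.le
    unfold gapPotential at h1 hpot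
    rw [Real.log_div ht10.ne' hδ0.ne']
    have h2 : 0 ≤ 8 * lam * M ^ 2 / t₁ := by positivity
    have h3 : 8 * lam * M ^ 2 / (y * ε / 2) = 16 * (lam * M ^ 2 / (ε * y ^ 2)) * y := by
      field_simp; norm_num
    have h4 : 16 * (lam * M ^ 2 / (ε * y ^ 2)) * y ≤ 16 * (lam * M ^ 2 / (ε * y ^ 2)) :=
      mul_le_of_le_one_right (by positivity) hy1
    linarith
  have hP0 : 0 < lam * M ^ 2 / (ε * y ^ 2) := by positivity
  have hQ0 : 0 ≤ lam * L / y ^ 2 := by positivity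
  have hylam : lam * L = lam * L / y ^ 2 * y ^ 2 := by field_simp
  generalize hq : Real.log (1 + L ^ 2 * D ^ 2 * Nbar / (16 * M ^ 2)) = lq at *
  generalize hP : lam * M ^ 2 / (ε * y ^ 2) = P at *
  generalize hQ : lam * L / y ^ 2 = Q at *
  have hlv := Real.log_le_sub_one_of_pos hv0
  generalize Real.log (t₁ / (y * ε / 2)) = l at *
  have hPl := mul_nonneg hP0.le hlogq
  have hQl := mul_nonneg hQ0 hlogq
  rcases le_or_gt (lam * L) (y / 4) with hsmall | hlarge
  · have h1 : l ≤ 8 * P - 1 := by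
      have := hsm hsmall ht₁
      linarith
    have h2 : 1 + 4 * lam * L ≤ 2 := by linarith
    have h3 : (1 + 4 * lam * L) * l ≤ 2 * (8 * P - 1) := mul_le_mul h2 h1 hlog0 (by norm_num)
    nlinarith
  · by_contra! hcon
    have hLpos : 0 < L := by
      by_contra! h
      have : lam * L ≤ 0 := mul_nonpos_of_nonneg_of_nonpos hlam.le h
      linarith
    have hQy : 1 / 4 < Q * y := by
      have : y * (1 / 4) < y * (Q * y) := by linarith
      exact lt_of_mul_lt_mul_left this hy0.le
    have h5 : Q * y ≤ Q := mul_le_of_le_one_right hQ0 hy1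
    have hjN : (j : ℝ) ≤ Nbar := by exact_mod_cast hj
    have hN : 28 * P ≤ Nbar := by linarith
    have hlog := hll _ (by positivity) (hlg hLpos hlarge.le hN ht₁)
    have h4 : Q * y * (M ^ 2 / (ε * L * y)) = P := by
      rw [← hP, ← hQ]; field_simp
    have h2 : 1 + 4 * lam * L ≤ 8 * (Q * y) := by
      have : lam * L ≤ Q * y := by
        rw [hylam]
        have := mul_le_mul_of_nonneg_right h5 hy0.le
        linarith
      linarith
    have h3 := mul_le_mul h2 hlog hlog0 (by positivity)
    have h6 := mul_le_mul_of_nonneg_right h5 hlogq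
    linarith

/-- With `lam₀ A / (Nbar ε) ≥ 2 ^ R` after `R + 1` resets, this makes `2 log (lam₀ U / (Nbar ε))`
larger than the number of resets. -/
theorem exp_half_lt (R : ℕ) : Real.exp ((R + 1 : ℝ) / 2) < 1 + 2 ^ R := by
  have hs : Real.exp (1 / 2) < 1.65 := by
    have h := Real.exp_one_lt_d9
    have e : Real.exp (1 / 2) ^ 2 = Real.exp 1 := by rw [← Real.exp_nat_mul]; norm_num
    by_contra! hc
    have : (1.65 : ℝ) ^ 2 ≤ Real.exp (1 / 2) ^ 2 := by gcongr
    rw [e] at this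
    norm_num at this
    linarith
  have key : ∀ R : ℕ, (1.65 : ℝ) ^ (R + 1) < 1 + 2 ^ R := by
    intro R
    rcases R with _ | R
    · norm_num
    · induction R with
      | zero => norm_num
      | succ k ih =>
        have : (1 : ℝ) ≤ 2 ^ k := one_le_pow₀ (by norm_num)
        rw [pow_succ]
        rw [pow_succ (2 : ℝ) (k + 1), pow_succ (2 : ℝ) k]
        rw [pow_succ (2 : ℝ) k] at ih
        nlinarith
  refine lt_of_le_of_lt ?_ (key R)
  have e : Real.exp ((R + 1 : ℝ) / 2) = Real.exp (1 / 2) ^ (R + 1) := by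
    rw [← Real.exp_nat_mul]; congr 1; push_cast; ring
  rw [e]
  gcongr

/-- One serious update lowers `log (d² + ε / m)` in proportion to the number `N` of iterations
of its cycle. -/
theorem log_decrease {ρ lam ε m w d d' N : ℝ} (hρ : 0 ≤ ρ) (hε : 0 < ε)
    (hm : 0 < m) (hw : 0 < w) (hρm : ρ ≤ lam * m)
    (hdec : (1 + ρ) * d' ^ 2 + lam * ε ≤ d ^ 2) (hN : N ≤ w * (ρ / (1 + ρ))) :
    Real.log (d' ^ 2 + ε / m) + N / w ≤ Real.log (d ^ 2 + ε / m) := by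
  have hεm : 0 < ε / m := by positivity
  have h1 : (1 + ρ) * (d' ^ 2 + ε / m) ≤ d ^ 2 + ε / m := by
    have : ρ * (ε / m) ≤ lam * ε := by
      have := mul_le_mul_of_nonneg_right hρm hεm.le
      have e : lam * m * (ε / m) = lam * ε := by field_simp
      linarith
    nlinarith
  have h2 := Real.log_le_log (by positivity) h1
  rw [Real.log_mul (by positivity) (by positivity)] at h2
  have h3 : N / w ≤ ρ / (1 + ρ) := by rw [div_le_iff₀ hw]; linarith
  have h4 := Real.one_sub_inv_le_log_of_pos (show 0 < 1 + ρ by positivity)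
  have e : ρ / (1 + ρ) = 1 - (1 + ρ)⁻¹ := by field_simp; ring
  linarith

/-! ### The hybrid composite problem in real numbers -/

theorem eq_coe_toReal {Φ : E n → EReal} (hΦ : ∀ x, Φ x ≠ ⊥) {x : E n} (hx : x ∈ effDom Φ) :
    Φ x = ((Φ x).toReal : EReal) := (EReal.coe_toReal (ne_of_lt hx) (hΦ x)).symm

section Problem

variable {f h : E n → EReal} {f' : E n → E n} {M L : ℝ}

theorem IsHybridProblem.f_eq (hp : IsHybridProblem f h f' M L) {x : E n} (hx : x ∈ effDom h) :
    f x = ((f x).toReal : EReal) := eq_coe_toReal hp.convex_f.convex.1 (hp.dom_subset hx)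

theorem IsHybridProblem.h_eq (hp : IsHybridProblem f h f' M L) {x : E n} (hx : x ∈ effDom h) :
    h x = ((h x).toReal : EReal) := eq_coe_toReal hp.convex_h.convex.1 hx

theorem IsHybridProblem.objective_eq (hp : IsHybridProblem f h f' M L) {x : E n}
    (hx : x ∈ effDom h) : objective f h x = (((f x).toReal + (h x).toReal : ℝ) : EReal) := by
  unfold objective
  rw [hp.f_eq hx, hp.h_eq hx]
  simp

theorem IsHybridProblem.objective_ne_bot (hp : IsHybridProblem f h f' M L) (x : E n) :
    objective f h x ≠ ⊥ := by
  unfold objective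
  rw [Ne, EReal.add_eq_bot_iff, not_or]
  exact ⟨hp.convex_f.convex.1 x, hp.convex_h.convex.1 x⟩

theorem mem_effDom_of_add_lt_top {m h : E n → EReal} {x : E n} (hm : m x ≠ ⊥)
    (hx : m x + h x < ⊤) : x ∈ effDom h := by
  by_contra hc
  have : h x = ⊤ := not_lt_top_iff.1 hc
  rw [this, EReal.add_top_of_ne_bot hm] at hx
  exact lt_irrefl _ hx

theorem IsHybridProblem.effDom_objective (hp : IsHybridProblem f h f' M L) :
    effDom (objective f h) = effDom h := by
  ext x
  constructor
  · intro hx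
    exact mem_effDom_of_add_lt_top (hp.convex_f.convex.1 x) hx
  · intro hx
    change objective f h x < ⊤
    rw [hp.objective_eq hx]
    exact EReal.coe_lt_top _

theorem IsHybridProblem.convexOn_f (hp : IsHybridProblem f h f' M L) :
    ConvexOn ℝ (effDom h) (fun x => (f x).toReal) :=
  (isConvexFn_iff_convexOn.1 hp.convex_f.convex).2.subset hp.dom_subset
    (isConvexFn_iff_convexOn.1 hp.convex_h.convex).2.1

theorem strongConvexOn_add_of_convexOn {C : Set (E n)} {g k : E n → ℝ} {m : ℝ}
    (hg : StrongConvexOn C m g) (hk : ConvexOn ℝ C k) :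
    StrongConvexOn C m (fun x => k x + g x) := by
  refine ⟨hg.1, fun x hx y hy a b ha hb hab => ?_⟩
  have h1 := hg.2 hx hy ha hb hab
  have h2 := hk.2 hx hy ha hb hab
  simp only [smul_eq_mul] at h1 h2 ⊢
  linarith

theorem IsHybridProblem.strongConvexOn_objective (hp : IsHybridProblem f h f' M L) {m : ℝ} :
    StrongConvexOn (effDom (objective f h)) m (fun x => (objective f h x).toReal) ↔
      StrongConvexOn (effDom h) m (fun x => (f x).toReal + (h x).toReal) := by
  have heq : Set.EqOn (fun x => (objective f h x).toReal)
      (fun x => (f x).toReal + (h x).toReal) (effDom h) := by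
    intro x hx
    simp only
    rw [hp.objective_eq hx, EReal.toReal_coe]
  rw [hp.effDom_objective]
  constructor
  · rintro ⟨h1, h2⟩
    refine ⟨h1, fun x hx y hy a b ha hb hab => ?_⟩
    have := h2 hx hy ha hb hab
    rwa [heq hx, heq hy, heq (h1 hx hy ha hb hab)] at this
  · rintro ⟨h1, h2⟩
    refine ⟨h1, fun x hx y hy a b ha hb hab => ?_⟩
    have := h2 hx hy ha hb hab
    rwa [heq hx, heq hy, heq (h1 hx hy ha hb hab)]

theorem IsHybridProblem.isConvexFn_objective (hp : IsHybridProblem f h f' M L) :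
    IsConvexFn (objective f h) := by
  refine isConvexFn_iff_convexOn.2 ⟨hp.objective_ne_bot, ?_⟩
  rw [← strongConvexOn_zero, hp.strongConvexOn_objective]
  exact strongConvexOn_add_of_convexOn
    (strongConvexOn_zero.2 (isConvexFn_iff_convexOn.1 hp.convex_h.convex).2) hp.convexOn_f

/-- Facts on the moduli `ν = μ(h)` and `μ = μ(f + h)`. -/
theorem IsHybridProblem.moduli (hp : IsHybridProblem f h f' M L)
    (hdom : (effDom h).Nontrivial) :
    0 ≤ intrinsicConvexity h ∧ intrinsicConvexity h ≤ intrinsicConvexity (objective f h) ∧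
      StrongConvexOn (effDom h) (intrinsicConvexity h) (fun x => (h x).toReal) ∧
      StrongConvexOn (effDom h) (intrinsicConvexity (objective f h))
        (fun x => (f x).toReal + (h x).toReal) := by
  obtain ⟨h1, h2, -⟩ := strongConvexOn_intrinsicConvexity hp.convex_h.convex hdom
  obtain ⟨-, h3, h4⟩ := strongConvexOn_intrinsicConvexity hp.isConvexFn_objective
    (hp.effDom_objective ▸ hdom)
  exact ⟨h1, h4 _ (hp.strongConvexOn_objective.2
    (strongConvexOn_add_of_convexOn h2 hp.convexOn_f)), h2, hp.strongConvexOn_objective.1 h3⟩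

theorem IsHybridProblem.isClosed_minimizers (hp : IsHybridProblem f h f' M L) :
    IsClosed (minimizers (objective f h)) := by
  have hlsc : LowerSemicontinuous (objective f h) := by
    refine hp.convex_f.lsc.add' hp.convex_h.lsc fun x => ?_
    exact EReal.continuousAt_add (Or.inr (hp.convex_h.convex.1 x))
      (Or.inl (hp.convex_f.convex.1 x))
  have e : minimizers (objective f h) = ⋂ y, objective f h ⁻¹' Set.Iic (objective f h y) := by
    ext x; simp [minimizers]
  rw [e]
  exact isClosed_iInter fun y => hlsc.isClosed_preimage _

theorem IsHybridProblem.mem_effDom_of_minimizer (hp : IsHybridProblem f h f' M L) {x x₀ : E n}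
    (hx : x ∈ minimizers (objective f h)) (hx₀ : x₀ ∈ effDom h) : x ∈ effDom h := by
  rw [← hp.effDom_objective] at hx₀ ⊢
  exact (hx x₀).trans_lt hx₀

theorem IsHybridProblem.lt_of_not_stops (hp : IsHybridProblem f h f' M L) {ε : ℝ} {x y : E n}
    (hx : x ∈ minimizers (objective f h)) (hxh : x ∈ effDom h) (hy : y ∈ effDom h)
    (hns : ¬ Stops f h ε y) :
    (f x).toReal + (h x).toReal + ε < (f y).toReal + (h y).toReal := by
  have e : (⨅ y, objective f h y) = objective f h x :=
    le_antisymm (iInf_le _ x) (le_iInf hx)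
  unfold Stops at hns
  rw [e, hp.objective_eq hxh, hp.objective_eq hy, ← EReal.coe_sub, not_le, EReal.coe_lt_coe_iff]
    at hns
  linarith

theorem IsHybridProblem.linearization_eq (hp : IsHybridProblem f h f' M L) {x : E n}
    (hx : x ∈ effDom h) (u : E n) :
    linearization f f' u x = (((f x).toReal + inner ℝ (f' x) (u - x) : ℝ) : EReal) := by
  unfold linearization
  rw [hp.f_eq hx]
  simp

/-- Linearization error of the hybrid class. -/
theorem IsHybridProblem.linearization_error (hp : IsHybridProblem f h f' M L) {x y : E n}
    (hx : x ∈ effDom h) (hy : y ∈ effDom h) :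
    (f y).toReal - ((f x).toReal + inner ℝ (f' x) (y - x)) ≤
      2 * M * ‖y - x‖ + L * ‖y - x‖ ^ 2 := by
  have h1 := hp.oracle y hy x
  rw [hp.f_eq hx, hp.f_eq hy, ← EReal.coe_add, EReal.coe_le_coe_iff] at h1
  have h2 : inner ℝ (f' y) (x - y) = -(inner ℝ (f' y) (y - x) : ℝ) := by
    rw [← inner_neg_right, neg_sub]
  have h3 : inner ℝ (f' y - f' x) (y - x) = inner ℝ (f' y) (y - x) - (inner ℝ (f' x) (y - x) : ℝ) :=
    inner_sub_left _ _ _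
  have h4 := real_inner_le_norm (f' y - f' x) (y - x)
  have h5 := mul_le_mul_of_nonneg_right (hp.hybrid y hy x hx) (norm_nonneg (y - x))
  nlinarith

/-- A minorant `m` of `f` whose sum with `h` avoids `-∞` is real-valued on `dom h`. -/
theorem IsHybridProblem.minorant_eq (hp : IsHybridProblem f h f' M L) {m : E n → EReal}
    (hb : ∀ u, m u + h u ≠ ⊥) (hm : ∀ u, m u ≤ f u) {u : E n} (hu : u ∈ effDom h) :
    m u = ((m u).toReal : EReal) ∧ (m u).toReal ≤ (f u).toReal := by
  have h1 : m u ≠ ⊥ := by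
    intro h0
    apply hb u
    rw [h0, EReal.bot_add]
  have h2 : m u = ((m u).toReal : EReal) :=
    (EReal.coe_toReal (ne_of_lt ((hm u).trans_lt (hp.dom_subset hu))) h1).symm
  refine ⟨h2, ?_⟩
  have := hm u
  rw [h2, hp.f_eq hu] at this
  exact_mod_cast this

theorem IsHybridProblem.prox_mem (hp : IsHybridProblem f h f' M L) {m : E n → EReal} {c x : E n}
    {lam : ℝ} (hb : ∀ u, m u ≠ ⊥) (hm : ∀ u, m u ≤ f u) (hc : c ∈ effDom h)
    (hx : IsProxPoint (fun u => m u + h u) c lam x) : x ∈ effDom h := by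
  have h1 := hx c
  have hbb : ∀ u, m u + h u ≠ ⊥ := by
    intro u
    rw [Ne, EReal.add_eq_bot_iff, not_or]
    exact ⟨hb u, hp.convex_h.convex.1 u⟩
  simp only [proxTerm] at h1
  rw [(hp.minorant_eq hbb hm hc).1, hp.h_eq hc, ← EReal.coe_add, ← EReal.coe_add] at h1
  refine mem_effDom_of_add_lt_top (hb x) ?_
  by_contra hcon
  rw [not_lt_top_iff.1 hcon, EReal.top_add_coe] at h1
  exact absurd h1 (not_le.2 (EReal.coe_lt_top _))

/-- Quadratic growth of a proximal subproblem with model `m`, in real numbers. -/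
theorem IsHybridProblem.prox_growth_minorant (hp : IsHybridProblem f h f' M L)
    {m : E n → EReal} {c x : E n} {lam κ : ℝ}
    (hb : ∀ u, m u + h u ≠ ⊥) (hm : ∀ u, m u ≤ f u) (hxh : x ∈ effDom h)
    (hcv : StrongConvexOn (effDom h) κ (fun u => (m u).toReal + (h u).toReal))
    (hx : IsProxPoint (fun u => m u + h u) c lam x) {u : E n} (hu : u ∈ effDom h) :
    (m x).toReal + (h x).toReal + 1 / (2 * lam) * ‖x - c‖ ^ 2 + (1 / lam + κ) / 2 * ‖u - x‖ ^ 2 ≤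
      (m u).toReal + (h u).toReal + 1 / (2 * lam) * ‖u - c‖ ^ 2 := by
  have e : 1 / (2 * lam) = 1 / lam / 2 := by rw [div_div, mul_comm]
  rw [e]
  refine prox_growth hcv hxh hu fun v hv => ?_
  have h1 := hx v
  simp only [proxTerm] at h1
  rw [(hp.minorant_eq hb hm hv).1, hp.h_eq hv, (hp.minorant_eq hb hm hxh).1, hp.h_eq hxh] at h1
  rw [e] at h1
  exact_mod_cast h1

end Problem

/-! ### Serious and null updates -/

section Serious

variable {χ ε lam μ ν V φy φs φu : ℝ} {xs x y c : E n}

/-- Decrease of the squared distance to a minimizer `xs` at a serious update, from quadratic growth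
of the last subproblem at `xs`. -/
theorem serious_decrease (hχ₀ : 0 ≤ χ) (hlam : 0 < lam) (hε : 0 < ε)
    (hgap : φy + χ / (2 * lam) * ‖y - c‖ ^ 2 ≤ (1 - χ) * ε / 2 + V) (hy : φs + ε < φy)
    (hgrow : V + (1 / lam + ν) / 2 * ‖xs - x‖ ^ 2 ≤ φs + 1 / (2 * lam) * ‖xs - c‖ ^ 2) :
    (1 + lam * ν) * ‖xs - x‖ ^ 2 + lam * ε ≤ ‖xs - c‖ ^ 2 := by
  have h0 : 0 ≤ χ / (2 * lam) * ‖y - c‖ ^ 2 := by positivity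
  have h1 : (1 / lam + ν) / 2 * ‖xs - x‖ ^ 2 + ε / 2 ≤ 1 / (2 * lam) * ‖xs - c‖ ^ 2 := by
    nlinarith
  have h2 := mul_le_mul_of_nonneg_left h1 (show 0 ≤ 2 * lam by positivity)
  have e1 : 2 * lam * ((1 / lam + ν) / 2 * ‖xs - x‖ ^ 2 + ε / 2) =
      (1 + lam * ν) * ‖xs - x‖ ^ 2 + lam * ε := by field_simp
  have e2 : 2 * lam * (1 / (2 * lam) * ‖xs - c‖ ^ 2) = ‖xs - c‖ ^ 2 := by field_simp
  linarith

/-- Decrease of the squared distance to a minimizer `xs` at a serious update, from strong convexity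
of the objective: quadratic growth of the last subproblem is used at `(1 - χ) xs + χ y`, where the
terms in `‖y - c‖²` cancel. -/
theorem serious_decrease_of_objective (hχ₀ : 0 ≤ χ) (hχ₁ : χ < 1) (hlam : 0 < lam) (hμ : 0 < μ)
    (hgap : φy + χ / (2 * lam) * ‖y - c‖ ^ 2 ≤ (1 - χ) * ε / 2 + V) (hy : φs + ε < φy)
    (hconv : φu ≤ (1 - χ) * φs + χ * φy - (1 - χ) * χ * (μ / 2 * ‖xs - y‖ ^ 2))
    (hgrow : V + 1 / (2 * lam) * ‖(1 - χ) • xs + χ • y - x‖ ^ 2 ≤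
      φu + 1 / (2 * lam) * ‖(1 - χ) • xs + χ • y - c‖ ^ 2) :
    (1 + χ * (lam * μ) / (1 + (1 - χ) * (lam * μ))) * ‖xs - x‖ ^ 2 + lam * ε ≤
      ‖xs - c‖ ^ 2 := by
  obtain ⟨z, rfl⟩ : ∃ z, χ = 1 - z := ⟨1 - χ, by ring⟩
  have hz : 0 < z := by linarith
  simp only [sub_sub_cancel] at *
  rw [norm_sq_affine_combination _ _ (by ring), norm_sq_affine_combination _ _ (by ring)] at hgrow
  have htri : ‖xs - x‖ ≤ ‖xs - y‖ + ‖y - x‖ := norm_sub_le_norm_sub_add_norm_sub _ _ _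
  have hx0 := norm_nonneg (xs - x)
  generalize ‖xs - y‖ = a at *
  generalize ‖y - x‖ = b at *
  generalize ‖xs - x‖ = d at *
  generalize ‖xs - c‖ = e at *
  generalize ‖y - c‖ = k at *
  have h1 : z * (2 * lam * (φy - φs) + (1 - z) * (lam * μ) * a ^ 2 + (1 - z) / z * b ^ 2) ≤
      z * (lam * ε + e ^ 2 - d ^ 2) := by
    have h2 : (φy - φs) * z + z * (1 - z) * (μ / 2 * a ^ 2) + (1 - z) / (2 * lam) * b ^ 2 ≤
        z * ε / 2 + z / (2 * lam) * (e ^ 2 - d ^ 2) := by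
      have e1 : 1 / (2 * lam) * (z * d ^ 2 + (1 - z) * b ^ 2 - z * (1 - z) * a ^ 2) =
        z / (2 * lam) * d ^ 2 + (1 - z) / (2 * lam) * b ^ 2 - z * (1 - z) / (2 * lam) * a ^ 2 := by
        ring
      have e2 : 1 / (2 * lam) * (z * e ^ 2 + (1 - z) * k ^ 2 - z * (1 - z) * a ^ 2) =
        z / (2 * lam) * e ^ 2 + (1 - z) / (2 * lam) * k ^ 2 - z * (1 - z) / (2 * lam) * a ^ 2 := by
        ring
      rw [e1, e2] at hgrow
      linarith
    have h3 := mul_le_mul_of_nonneg_left h2 (show 0 ≤ 2 * lam by positivity)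
    have e3 : 2 * lam * ((φy - φs) * z + z * (1 - z) * (μ / 2 * a ^ 2) +
        (1 - z) / (2 * lam) * b ^ 2) =
        z * (2 * lam * (φy - φs) + (1 - z) * (lam * μ) * a ^ 2 + (1 - z) / z * b ^ 2) := by
      field_simp
    have e4 : 2 * lam * (z * ε / 2 + z / (2 * lam) * (e ^ 2 - d ^ 2)) =
        z * (lam * ε + e ^ 2 - d ^ 2) := by field_simp; ring
    linarith
  have h2 := le_of_mul_le_mul_left h1 hz
  have hp : 0 < lam * μ := by positivity
  generalize lam * μ = p at *
  have h3 : (1 - z) * p / (1 + z * p) * d ^ 2 ≤ (1 - z) * p * a ^ 2 + (1 - z) / z * b ^ 2 := by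
    have hd : d ^ 2 ≤ (a + b) ^ 2 := by gcongr
    have e5 : (1 - z) * p * a ^ 2 + (1 - z) / z * b ^ 2 -
        (1 - z) * p / (1 + z * p) * (a + b) ^ 2 =
        (1 - z) / (z * (1 + z * p)) * (b - z * p * a) ^ 2 := by field_simp; ring
    have h4 : 0 ≤ (1 - z) / (z * (1 + z * p)) * (b - z * p * a) ^ 2 := by positivity
    have h5 : (1 - z) * p / (1 + z * p) * d ^ 2 ≤ (1 - z) * p / (1 + z * p) * (a + b) ^ 2 := by
      gcongr
    linarith
  have h4 : lam * ε ≤ lam * (φy - φs) := mul_le_mul_of_nonneg_left (by linarith) hlam.le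
  linarith

end Serious

/-- The pairs of a modulus `m > 0` and a factor `w` for which the number of iterations in serious
cycles is at most `w log (1 + m d² / ε)`. -/
def IsRate (χ ε μ ν U : ℝ) (Nbar : ℕ) (m w : ℝ) : Prop :=
  0 < m ∧ ((0 < χ ∧ m = μ ∧ w = 1 / χ * (Nbar + U / (μ * ε))) ∨
    (m = ν ∧ w = Nbar + U / (ν * ε)))

/-- The information carried by a cycle in which at least one null update was made: `p` is the last
iterate, `V` the optimal value of its subproblem, `y` the iterate at which the current best value
`β` is attained, and `t₁`, `r` the first gap of the cycle and the distance it is bounded through.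
The last two conditions say what the model retains of the last subproblem and of the linearization
at `p`. -/
def NullData (f h : E n → EReal) (f' : E n → E n) (M L D χ ε : ℝ) (s : State n) : Prop :=
  ∃ p ∈ effDom h, ∃ y ∈ effDom h, ∃ V β t₁ r : ℝ,
    s.best = (β : EReal) ∧
    β = (f y).toReal + (h y).toReal + χ / (2 * s.stepsize) * ‖y - s.center‖ ^ 2 ∧
    ¬ Stops f h ε y ∧
    (1 - χ) * ε / 2 < β - V ∧ (1 - χ) * ε / 2 < t₁ ∧ 0 ≤ r ∧ r ≤ D ∧
    t₁ ≤ 2 * M * r + L * r ^ 2 - (1 - χ) / (2 * s.stepsize) * r ^ 2 ∧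
    gapPotential M L s.stepsize (β - V) + s.count ≤ gapPotential M L s.stepsize t₁ + 1 ∧
    (∀ u ∈ effDom h, V + 1 / (2 * s.stepsize) * ‖u - p‖ ^ 2 ≤
      (s.model u).toReal + (h u).toReal + 1 / (2 * s.stepsize) * ‖u - s.center‖ ^ 2) ∧
    ∀ u ∈ effDom h, (f p).toReal + inner ℝ (f' p) (u - p) ≤ (s.model u).toReal

/-- Invariant of a cycle at the start of an inner iteration. -/
structure CycleInv (f h : E n → EReal) (f' : E n → E n) (M L D χ ε : ℝ) (s : State n) :
    Prop where
  center_mem : s.center ∈ effDom h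
  model_convex : IsClosedProperConvex s.model
  model_le : ∀ u, s.model u ≤ f u
  initial : s.count = 0 → ∀ u ∈ effDom h,
    (f s.center).toReal + inner ℝ (f' s.center) (u - s.center) ≤ (s.model u).toReal
  null : s.count ≠ 0 → NullData f h f' M L D χ ε s

section Iteration

variable {f h : E n → EReal} {f' : E n → E n} {M L D χ ε lam₀ ν : ℝ} {Nbar : ℕ}

theorem IsHybridProblem.model_add_ne_bot (hp : IsHybridProblem f h f' M L) {m : E n → EReal}
    (hm : IsClosedProperConvex m) (u : E n) : m u + h u ≠ ⊥ := by
  rw [Ne, EReal.add_eq_bot_iff, not_or]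
  exact ⟨hm.convex.1 u, hp.convex_h.convex.1 u⟩

theorem IsHybridProblem.cycleInv_of_initial (hp : IsHybridProblem f h f' M L) {s : State n}
    (hc : s.center ∈ effDom h) (h0 : s.count = 0) (hm : IsInitialModel f f' s.center s.model) :
    CycleInv f h f' M L D χ ε s where
  center_mem := hc
  model_convex := hm.1
  model_le u := (hm.2 u).2
  initial := by
    intro _ u hu
    have h1 := (hm.2 u).1
    rw [hp.linearization_eq hc,
      (hp.minorant_eq (hp.model_add_ne_bot hm.1) (fun u => (hm.2 u).2) hu).1] at h1
    exact_mod_cast h1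
  null h := absurd h0 h

/-- What an inner iteration that does not stop yields, in real numbers. -/
structure IterationData (f h : E n → EReal) (M L D χ ε ν : ℝ) (s : State n) (x : E n)
    (V β : ℝ) (y : E n) : Prop where
  mem : x ∈ effDom h
  best_mem : y ∈ effDom h
  best_not_stops : ¬ Stops f h ε y
  best_eq : β = (f y).toReal + (h y).toReal + χ / (2 * s.stepsize) * ‖y - s.center‖ ^ 2
  newBest_eq : newBest f h χ s x = (β : EReal)
  gap_eq : gap f h χ s x = ((β - V : ℝ) : EReal)
  value_eq : V = (s.model x).toReal + (h x).toReal + 1 / (2 * s.stepsize) * ‖x - s.center‖ ^ 2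
  growth : ∀ u ∈ effDom h, V + (1 / s.stepsize + ν) / 2 * ‖u - x‖ ^ 2 ≤
    (f u).toReal + (h u).toReal + 1 / (2 * s.stepsize) * ‖u - s.center‖ ^ 2
  null : (1 - χ) * ε / 2 < β - V → ∃ t₁ r : ℝ, (1 - χ) * ε / 2 < t₁ ∧ 0 ≤ r ∧ r ≤ D ∧
    t₁ ≤ 2 * M * r + L * r ^ 2 - (1 - χ) / (2 * s.stepsize) * r ^ 2 ∧
    gapPotential M L s.stepsize (β - V) + (s.count + 1 : ℕ) ≤ gapPotential M L s.stepsize t₁ + 1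

theorem CycleInv.iteration (hp : IsHybridProblem f h f' M L) (hM : 0 < M) (hL : 0 ≤ L)
    (hD : ∀ x ∈ effDom h, ∀ y ∈ effDom h, ‖x - y‖ ≤ D)
    (hχ₁ : χ < 1) (hε : 0 < ε)
    (hν : StrongConvexOn (effDom h) ν (fun x => (h x).toReal))
    {s : State n} (hs : CycleInv f h f' M L D χ ε s) (hlam : 0 < s.stepsize) {x : E n}
    (hx : IsProxPoint (fun u => s.model u + h u) s.center s.stepsize x)
    (hns : ¬ Stops f h ε x) :
    ∃ V β y, IterationData f h M L D χ ε ν s x V β y := by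
  have hnb := hp.model_add_ne_bot hs.model_convex
  have hxh : x ∈ effDom h :=
    hp.prox_mem hs.model_convex.convex.1 hs.model_le hs.center_mem hx
  have hmx := hp.minorant_eq hnb hs.model_le hxh
  have hmconv : ConvexOn ℝ (effDom h) (fun u => (s.model u).toReal) :=
    (isConvexFn_iff_convexOn.1 hs.model_convex.convex).2.subset
      (fun u hu => (hs.model_le u).trans_lt (hp.dom_subset hu)) hν.1
  have hgrow := fun u hu => hp.prox_growth_minorant hnb hs.model_le hxh
    (strongConvexOn_add_of_convexOn hν hmconv) hx (u := u) hu
  obtain ⟨V, hV⟩ : ∃ V, V = (s.model x).toReal + (h x).toReal +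
    1 / (2 * s.stepsize) * ‖x - s.center‖ ^ 2 := ⟨_, rfl⟩
  rw [← hV] at hgrow
  have hVe : s.model x + h x + proxTerm 1 s.stepsize s.center x = (V : EReal) := by
    rw [hmx.1, hp.h_eq hxh, hV]; simp [proxTerm]
  obtain ⟨w, hw⟩ : ∃ w, w = (f x).toReal + (h x).toReal +
    χ / (2 * s.stepsize) * ‖x - s.center‖ ^ 2 := ⟨_, rfl⟩
  have hwe : objective f h x + proxTerm χ s.stepsize s.center x = (w : EReal) := by
    rw [hp.objective_eq hxh, hw]; simp [proxTerm]
  have hsplit : 1 / (2 * s.stepsize) * ‖x - s.center‖ ^ 2 =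
      χ / (2 * s.stepsize) * ‖x - s.center‖ ^ 2 +
      (1 - χ) / (2 * s.stepsize) * ‖x - s.center‖ ^ 2 := by ring
  have hδ : 0 < (1 - χ) * ε / 2 := by
    have : 0 < 1 - χ := by linarith
    positivity
  have hgrow' : ∀ u ∈ effDom h, V + (1 / s.stepsize + ν) / 2 * ‖u - x‖ ^ 2 ≤
      (f u).toReal + (h u).toReal + 1 / (2 * s.stepsize) * ‖u - s.center‖ ^ 2 := by
    intro u hu
    have h1 := hgrow u hu
    have h2 := (hp.minorant_eq hnb hs.model_le hu).2
    linarith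
  by_cases h0 : s.count = 0
  · have hnew : newBest f h χ s x = (w : EReal) := by rw [newBest, if_pos h0, hwe]
    refine ⟨V, w, x, hxh, hxh, hns, hw, hnew, ?_, hV, hgrow', ?_⟩
    · rw [gap, hnew, hVe, ← EReal.coe_sub]
    · intro hgap
      refine ⟨w - V, ‖x - s.center‖, hgap, norm_nonneg _, hD _ hxh _ hs.center_mem, ?_, ?_⟩
      · have h1 := hs.initial h0 x hxh
        have h2 := hp.linearization_error hs.center_mem hxh
        linarith
      · rw [h0]; norm_num
  · obtain ⟨p, hph, y, hyh, V', β', t₁, r, hbest, hβ', hyns, hgap', ht₁, hr, hrD, ht₁r, hpot,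
      hmodel, hlin⟩ := hs.null h0
    have hnew : newBest f h χ s x = ((min β' w : ℝ) : EReal) := by
      rw [newBest, if_neg h0, hwe, hbest]
      exact (EReal.coe_strictMono.monotone.map_min).symm
    have key : ∀ y' ∈ effDom h, ¬ Stops f h ε y' → min β' w = (f y').toReal + (h y').toReal +
        χ / (2 * s.stepsize) * ‖y' - s.center‖ ^ 2 →
        IterationData f h M L D χ ε ν s x V (min β' w) y' := by
      intro y' hy' hns' hmin
      refine ⟨hxh, hy', hns', hmin, hnew, ?_, hV, hgrow', ?_⟩
      · rw [gap, hnew, hVe, ← EReal.coe_sub]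
      · intro hgap
        refine ⟨t₁, r, ht₁, hr, hrD, ht₁r, ?_⟩
        have h1 := hmodel x hxh
        rw [← hV] at h1
        have h2 := hlin x hxh
        have h3 := hp.linearization_error hph hxh
        have h4 : 0 ≤ (1 - χ) / (2 * s.stepsize) * ‖x - s.center‖ ^ 2 := by
          have : 0 < 1 - χ := by linarith
          positivity
        have h5 := gapPotential_add_one_le hM hL hlam (norm_nonneg (x - p)) (hδ.trans hgap)
          (t' := β' - V') (by have := min_le_right β' w; linarith)
          (by
            have := min_le_left β' w
            have e : ‖x - p‖ ^ 2 / (2 * s.stepsize) = 1 / (2 * s.stepsize) * ‖x - p‖ ^ 2 := by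
              ring
            linarith)
        push_cast
        linarith
    rcases min_choice β' w with hmin | hmin
    · exact ⟨V, min β' w, y, key y hyh hyns (hmin.trans hβ')⟩
    · exact ⟨V, min β' w, x, key x hxh hns (hmin.trans hw)⟩

theorem IterationData.null_update (hp : IsHybridProblem f h f' M L) {s s' : State n} {x : E n}
    (hs : CycleInv f h f' M L D χ ε s) {V β : ℝ} {y : E n}
    (hd : IterationData f h M L D χ ε ν s x V β y)
    (hu : IsNullUpdate f h f' χ ε Nbar s x s') : CycleInv f h f' M L D χ ε s' := by
  obtain ⟨hgap, -, hc, hlam, hcount, hbest, hconv, mBar, hBconv, hBle, hBx, hBprox, hB⟩ := hu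
  rw [hd.gap_eq, EReal.coe_lt_coe_iff] at hgap
  obtain ⟨t₁, r, ht₁, hr, hrD, ht₁r, hpot⟩ := hd.null hgap
  have hnb := hp.model_add_ne_bot hconv
  refine ⟨hc ▸ hs.center_mem, hconv, fun u => (hB u).2, fun h0 => by omega, fun _ => ?_⟩
  refine ⟨x, hd.mem, y, hd.best_mem, V, β, t₁, r, hbest.trans hd.newBest_eq, ?_,
    hd.best_not_stops, hgap, ht₁, hr, hrD, ?_, ?_, fun u hu => ?_, fun u hu => ?_⟩
  · rw [hc, hlam]; exact hd.best_eq
  · rw [hlam]; exact ht₁r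
  · rw [hlam, hcount]; exact hpot
  · have hcv : StrongConvexOn (effDom h) 0 (fun u => (mBar u).toReal + (h u).toReal) := by
      rw [strongConvexOn_zero]
      have h1 := (isConvexFn_iff_convexOn.1 hBconv.convex).2
      have hsub : effDom h ⊆ effDom (fun u => mBar u + h u) := by
        intro v hv
        change mBar v + h v < ⊤
        rw [(hp.minorant_eq hBconv.convex.1 hBle hv).1, hp.h_eq hv, ← EReal.coe_add]
        exact EReal.coe_lt_top _
      refine (h1.subset hsub (isConvexFn_iff_convexOn.1 hp.convex_h.convex).2.1).congr ?_
      intro v hv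
      have e : mBar v + h v = (((mBar v).toReal + (h v).toReal : ℝ) : EReal) := by
        rw [EReal.coe_add, ← (hp.minorant_eq hBconv.convex.1 hBle hv).1, ← hp.h_eq hv]
      simp only
      rw [e, EReal.toReal_coe]
    have h2 := hp.prox_growth_minorant hBconv.convex.1 hBle hd.mem hcv hBprox hu
    rw [hBx, ← hd.value_eq] at h2
    have h3 := (le_max_left _ _).trans (hB u).1
    rw [(hp.minorant_eq hBconv.convex.1 hBle hu).1,
      (hp.minorant_eq hnb (fun u => (hB u).2) hu).1, EReal.coe_le_coe_iff] at h3
    rw [hc, hlam]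
    have e : (1 / s.stepsize + 0) / 2 = 1 / (2 * s.stepsize) := by
      rw [add_zero, div_div, mul_comm]
    rw [e] at h2
    linarith
  · have h3 := (le_max_right _ _).trans (hB u).1
    rw [hp.linearization_eq hd.mem, (hp.minorant_eq hnb (fun u => (hB u).2) hu).1] at h3
    exact_mod_cast h3

/-- Decrease of the distance to a minimizer at a serious update, for both kinds of rates. -/
theorem IterationData.serious (hp : IsHybridProblem f h f' M L) (hχ₀ : 0 ≤ χ) (hχ₁ : χ < 1)
    (hε : 0 < ε) (hν₀ : 0 ≤ ν) {μ U : ℝ} (hU : 0 < U) (hNbar : 1 ≤ Nbar)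
    (hμ : StrongConvexOn (effDom h) μ (fun x => (f x).toReal + (h x).toReal))
    {xs : E n} (hxs : xs ∈ minimizers (objective f h)) (hxsh : xs ∈ effDom h)
    {s : State n} (hlam : 0 < s.stepsize) {x : E n} {V β : ℝ} {y : E n}
    (hd : IterationData f h M L D χ ε ν s x V β y) (hgap : β - V ≤ (1 - χ) * ε / 2)
    {N : ℝ} (hN : N ≤ Nbar) (hNU : N * ε ≤ s.stepsize * U) :
    N * (ε ^ 2 / U) + ‖xs - x‖ ^ 2 ≤ ‖xs - s.center‖ ^ 2 ∧
    ∀ m w, IsRate χ ε μ ν U Nbar m w →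
      Real.log (‖xs - x‖ ^ 2 + ε / m) + N / w ≤ Real.log (‖xs - s.center‖ ^ 2 + ε / m) := by
  have hNpos : (0 : ℝ) < Nbar := by exact_mod_cast hNbar
  have hy := hp.lt_of_not_stops hxs hxsh hd.best_mem hd.best_not_stops
  have hg : (f y).toReal + (h y).toReal + χ / (2 * s.stepsize) * ‖y - s.center‖ ^ 2 ≤
      (1 - χ) * ε / 2 + V := by
    rw [← hd.best_eq]; linarith
  have h1 := serious_decrease hχ₀ hlam hε hg hy (hd.growth xs hxsh)
  refine ⟨?_, ?_⟩
  · have h2 : N * (ε ^ 2 / U) ≤ s.stepsize * ε := by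
      rw [← mul_div_assoc, div_le_iff₀ hU]
      have := mul_le_mul_of_nonneg_right hNU hε.le
      linarith
    have h3 : 0 ≤ s.stepsize * ν * ‖xs - x‖ ^ 2 := by positivity
    linarith
  · rintro m w ⟨hm, ⟨hχ, rfl, rfl⟩ | ⟨rfl, rfl⟩⟩
    · set u := (1 - χ) • xs + χ • y with hu
      have hb := hμ.2 hxsh hd.best_mem (sub_nonneg.2 hχ₁.le) hχ₀ (by ring)
      have hum : u ∈ effDom h := hμ.1 hxsh hd.best_mem (sub_nonneg.2 hχ₁.le) hχ₀ (by ring)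
      simp only [smul_eq_mul] at hb
      have hgr : V + 1 / (2 * s.stepsize) * ‖u - x‖ ^ 2 ≤
          (f u).toReal + (h u).toReal + 1 / (2 * s.stepsize) * ‖u - s.center‖ ^ 2 := by
        have h2 := hd.growth u hum
        have e : (1 / s.stepsize + ν) / 2 * ‖u - x‖ ^ 2 =
            1 / (2 * s.stepsize) * ‖u - x‖ ^ 2 + ν / 2 * ‖u - x‖ ^ 2 := by
          field_simp
        have : 0 ≤ ν / 2 * ‖u - x‖ ^ 2 := by positivity
        linarith
      have h2 := serious_decrease_of_objective hχ₀ hχ₁ hlam hm hg hy hb hgr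
      have hz : 0 < 1 - χ := by linarith
      have hp0 : 0 < s.stepsize * m := by positivity
      refine log_decrease (by positivity) hε hm (by positivity) ?_ h2 ?_
      · rw [div_le_iff₀ (by positivity)]
        have : 0 ≤ (1 - χ) * (s.stepsize * m) * (s.stepsize * m) := by positivity
        have : χ * (s.stepsize * m) ≤ 1 * (s.stepsize * m) := by gcongr
        linarith
      · have e : 1 / χ * (Nbar + U / (m * ε)) * (χ * (s.stepsize * m) /
            (1 + (1 - χ) * (s.stepsize * m)) / (1 + χ * (s.stepsize * m) /
            (1 + (1 - χ) * (s.stepsize * m)))) =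
            (Nbar * (s.stepsize * m) + s.stepsize * U / ε) / (1 + s.stepsize * m) := by
          have e1 : 1 + χ * (s.stepsize * m) / (1 + (1 - χ) * (s.stepsize * m)) =
              (1 + s.stepsize * m) / (1 + (1 - χ) * (s.stepsize * m)) := by
            field_simp; ring
          rw [e1, div_div_div_cancel_right₀ (by positivity)]
          field_simp
        rw [e, le_div_iff₀ (by positivity)]
        have h3 : N ≤ s.stepsize * U / ε := by rwa [le_div_iff₀ hε]
        have h4 := mul_le_mul_of_nonneg_right hN hp0.le
        linarith
    · have hp0 : 0 < s.stepsize * m := by positivity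
      refine log_decrease hp0.le hε hm (by positivity) le_rfl h1 ?_
      have e : (Nbar + U / (m * ε)) * (s.stepsize * m / (1 + s.stepsize * m)) =
          (Nbar * (s.stepsize * m) + s.stepsize * U / ε) / (1 + s.stepsize * m) := by
        field_simp
      rw [e, le_div_iff₀ (by positivity)]
      have h3 : N ≤ s.stepsize * U / ε := by rwa [le_div_iff₀ hε]
      have h4 := mul_le_mul_of_nonneg_right hN hp0.le
      linarith

end Iteration

/-! ### Accounting along an execution -/

section Execution

variable {f h : E n → EReal} {f' : E n → E n} {M L D χ ε lam₀ μ ν : ℝ} {Nbar : ℕ} {x₀ : E n}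

/-- The part `A` of `U = A + Nbar ε / lam₀` that does not depend on the initial stepsize. -/
noncomputable def nullConst (M L D χ ε : ℝ) (Nbar : ℕ) : ℝ :=
  4 * (M ^ 2 + ε * L) * constB M L D Nbar / (1 - χ) ^ 2

theorem nullConst_pos (hM : 0 < M) (hL : 0 ≤ L) (hχ₁ : χ < 1) (hε : 0 < ε) :
    0 < nullConst M L D χ ε Nbar := by
  have h1 : 0 ≤ Real.log (1 + L ^ 2 * D ^ 2 * Nbar / (16 * M ^ 2)) := by
    apply Real.log_nonneg
    have : 0 ≤ L ^ 2 * D ^ 2 * Nbar / (16 * M ^ 2) := by positivity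
    linarith
  have h2 : 0 < 1 - χ := by linarith
  unfold nullConst constB
  positivity

/-- Accounting of the iterations made before iteration `j`: `S` of them belong to completed
serious cycles, `Nbar R` to `R` reset cycles and `s.count` to the current cycle. -/
structure Progress (f h : E n → EReal) (f' : E n → E n) (M L D χ ε lam₀ μ ν : ℝ) (Nbar : ℕ)
    (x₀ xs : E n) (j : ℕ) (s : State n) (S : ℝ) (R : ℕ) : Prop where
  cycle : CycleInv f h f' M L D χ ε s
  count_eq : (j : ℝ) = S + Nbar * R + s.count + 1
  count_lt : s.count + 1 ≤ Nbar
  stepsize_eq : s.stepsize = lam₀ / 2 ^ R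
  reset : R ≠ 0 → (Nbar + 1 : ℝ) ≤ 2 * s.stepsize * nullConst M L D χ ε Nbar / ε
  dist : S * (ε ^ 2 / constU M L D χ lam₀ ε Nbar) + ‖xs - s.center‖ ^ 2 ≤ ‖xs - x₀‖ ^ 2
  rate : ∀ m w, IsRate χ ε μ ν (constU M L D χ lam₀ ε Nbar) Nbar m w →
    Real.log (‖xs - s.center‖ ^ 2 + ε / m) + S / w ≤ Real.log (‖xs - x₀‖ ^ 2 + ε / m)

theorem NullData.count_add_one_le (hM : 0 < M) (hL : 0 ≤ L) (hχ₀ : 0 ≤ χ) (hχ₁ : χ < 1)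
    (hε : 0 < ε) {s : State n} (hlam : 0 < s.stepsize) (hN : s.count ≤ Nbar)
    (hs : NullData f h f' M L D χ ε s) :
    (s.count : ℝ) + 1 ≤ s.stepsize * nullConst M L D χ ε Nbar / ε := by
  obtain ⟨p, hp, y, hy, V, β, t₁, r, -, -, -, hgap, ht₁, hr, hrD, ht₁r, hpot, -, -⟩ := hs
  exact null_count_bound hM hL hχ₀ hχ₁ hε hlam hr hrD hN ht₁r ht₁ hgap hpot

theorem Progress.step (hp : IsHybridProblem f h f' M L) (hM : 0 < M) (hL : 0 ≤ L)
    (hD : ∀ x ∈ effDom h, ∀ y ∈ effDom h, ‖x - y‖ ≤ D)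
    (hχ₀ : 0 ≤ χ) (hχ₁ : χ < 1) (hlam₀ : 0 < lam₀) (hε : 0 < ε) (hNbar : 1 ≤ Nbar) (hν₀ : 0 ≤ ν)
    (hν : StrongConvexOn (effDom h) ν (fun x => (h x).toReal))
    (hμ : StrongConvexOn (effDom h) μ (fun x => (f x).toReal + (h x).toReal))
    {xs : E n} (hxs : xs ∈ minimizers (objective f h)) (hxsh : xs ∈ effDom h)
    {j : ℕ} {s s' : State n} {S : ℝ} {R : ℕ} (hS : 0 ≤ S)
    (hP : Progress f h f' M L D χ ε lam₀ μ ν Nbar x₀ xs j s S R) {x : E n}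
    (hx : IsProxPoint (fun u => s.model u + h u) s.center s.stepsize x)
    (hns : ¬ Stops f h ε x)
    (hup : IsNullUpdate f h f' χ ε Nbar s x s' ∨ IsResetUpdate f h f' χ ε Nbar s x s' ∨
      IsSeriousUpdate f h f' χ ε Nbar s x s') :
    ∃ S' R', 0 ≤ S' ∧ Progress f h f' M L D χ ε lam₀ μ ν Nbar x₀ xs (j + 1) s' S' R' := by
  have hlam : 0 < s.stepsize := by rw [hP.stepsize_eq]; positivity
  have hA := nullConst_pos (D := D) (Nbar := Nbar) hM hL hχ₁ hε
  have hUA : constU M L D χ lam₀ ε Nbar = nullConst M L D χ ε Nbar + Nbar * ε / lam₀ := rfl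
  have hU : 0 < constU M L D χ lam₀ ε Nbar := by rw [hUA]; positivity
  obtain ⟨V, β, y, hd⟩ := hP.cycle.iteration hp hM hL hD hχ₁ hε hν hlam hx hns
  rcases hup with hu | hu | hu
  · have hc := hd.null_update hp hP.cycle hu
    obtain ⟨-, hlt, hcen, hstep, hcount, -⟩ := hu
    refine ⟨S, R, hS, hc, ?_, by omega, hstep.trans hP.stepsize_eq, ?_, ?_, ?_⟩
    · rw [hcount]; push_cast; linarith [hP.count_eq]
    · rw [hstep]; exact hP.reset
    · rw [hcen]; exact hP.dist
    · rw [hcen]; exact hP.rate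
  · obtain ⟨hgap, hN, hcen, hstep, hcount, hinit⟩ := hu
    rw [hd.gap_eq, EReal.coe_lt_coe_iff] at hgap
    obtain ⟨t₁, r, ht₁, hr, hrD, ht₁r, hpot⟩ := hd.null hgap
    have hb := null_count_bound hM hL hχ₀ hχ₁ hε hlam hr hrD hN.le ht₁r ht₁ hgap hpot
    rw [hN] at hb
    refine ⟨S, R + 1, hS, hp.cycleInv_of_initial (hcen ▸ hP.cycle.center_mem) hcount
      (hcen ▸ hinit), ?_, by omega, ?_, fun _ => ?_, ?_, ?_⟩
    · have h1 := hP.count_eq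
      have h2 : (s.count : ℝ) + 1 = Nbar := by exact_mod_cast hN
      rw [hcount]; push_cast; linarith
    · rw [hstep, hP.stepsize_eq, pow_succ, div_div]
    · rw [hstep, mul_div_cancel₀ _ (two_ne_zero)]
      exact hb
    · rw [hcen]; exact hP.dist
    · rw [hcen]; exact hP.rate
  · obtain ⟨hgap, hN, hcen, hstep, hcount, hinit⟩ := hu
    rw [hd.gap_eq, EReal.coe_le_coe_iff] at hgap
    have hNr : (s.count : ℝ) + 1 ≤ Nbar := by exact_mod_cast hN
    have hNb1 : (1 : ℝ) ≤ Nbar := by exact_mod_cast hNbar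
    -- the number of iterations of the cycle is at most `lam U / ε`
    have hNU : ((s.count : ℝ) + 1) * ε ≤ s.stepsize * constU M L D χ lam₀ ε Nbar := by
      rw [hUA, mul_add]
      have h1 : 0 ≤ s.stepsize * (Nbar * ε / lam₀) := by positivity
      have h2 : 0 < s.stepsize * nullConst M L D χ ε Nbar := by positivity
      by_cases hR : R = 0
      · have e : s.stepsize = lam₀ := by rw [hP.stepsize_eq, hR]; simp
        have e2 : lam₀ * (Nbar * ε / lam₀) = Nbar * ε := by field_simp
        rw [e] at h2 ⊢
        rw [e2]
        have := mul_le_mul_of_nonneg_right hNr hε.le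
        linarith
      · by_cases h0 : s.count = 0
        · -- the stepsize was halved, so that twice the stepsize admits a full failing cycle
          have h3 := hP.reset hR
          rw [le_div_iff₀ hε] at h3
          rw [h0]
          push_cast
          have := mul_le_mul_of_nonneg_right hNb1 hε.le
          linarith
        · have h3 := (hP.cycle.null h0).count_add_one_le hM hL hχ₀ hχ₁ hε hlam
            (Nbar := Nbar) (by omega)
          rw [le_div_iff₀ hε] at h3
          linarith
    obtain ⟨h1, h2⟩ := hd.serious hp hχ₀ hχ₁ hε hν₀ hU hNbar hμ hxs hxsh hlam hgap hNr hNU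
    refine ⟨S + (s.count + 1), R, by positivity, hp.cycleInv_of_initial (hcen ▸ hd.mem) hcount
      (hcen ▸ hinit), ?_, by omega, hstep.trans hP.stepsize_eq, ?_, ?_, ?_⟩
    · rw [hcount]; push_cast; linarith [hP.count_eq]
    · rw [hstep]; exact hP.reset
    · rw [hcen, add_mul]
      linarith [hP.dist]
    · intro m w hw
      rw [hcen, add_div]
      linarith [hP.rate m w hw, h2 m w hw]

theorem IsExecution.exists_progress (hp : IsHybridProblem f h f' M L) (hM : 0 < M) (hL : 0 ≤ L)
    (hD : ∀ x ∈ effDom h, ∀ y ∈ effDom h, ‖x - y‖ ≤ D) (hx₀ : x₀ ∈ effDom h)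
    (hχ₀ : 0 ≤ χ) (hχ₁ : χ < 1) (hlam₀ : 0 < lam₀) (hε : 0 < ε) (hNbar : 1 ≤ Nbar) (hν₀ : 0 ≤ ν)
    (hν : StrongConvexOn (effDom h) ν (fun x => (h x).toReal))
    (hμ : StrongConvexOn (effDom h) μ (fun x => (f x).toReal + (h x).toReal))
    {xs : E n} (hxs : xs ∈ minimizers (objective f h)) (hxsh : xs ∈ effDom h)
    {J : ℕ} {s : ℕ → State n} {x : ℕ → E n}
    (hexec : IsExecution f h f' x₀ χ lam₀ ε Nbar J s x) (j : ℕ) (hj : j + 1 ≤ max J 1) :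
    ∃ S R, 0 ≤ S ∧ Progress f h f' M L D χ ε lam₀ μ ν Nbar x₀ xs (j + 1) (s (j + 1)) S R := by
  induction j with
  | zero =>
    obtain ⟨hc, hl, hcount, hinit⟩ := hexec.initial
    refine ⟨0, 0, le_rfl, hp.cycleInv_of_initial (hc ▸ hx₀) hcount (hc ▸ hinit), ?_, ?_, ?_, ?_,
      ?_, ?_⟩
    · simp [hcount]
    · change (s 1).count + 1 ≤ Nbar
      omega
    · simpa using hl
    · simp
    · simp [hc]
    · simp [hc]
  | succ j ih =>
    obtain ⟨S, R, hS, hP⟩ := ih (by omega)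
    exact hP.step hp hM hL hD hχ₀ hχ₁ hlam₀ hε hNbar hν₀ hν hμ hxs hxsh hS
      (hexec.prox _ (by omega) (by omega)) (hexec.continues _ (by omega) (by omega))
      (hexec.update _ (by omega) (by omega))

/-- The number of resets, plus one for the unfinished cycle. -/
theorem Progress.resets_le (hM : 0 < M) (hL : 0 ≤ L) (hχ₁ : χ < 1) (hlam₀ : 0 < lam₀)
    (hε : 0 < ε) (hNbar : 1 ≤ Nbar) {xs : E n} {j : ℕ} {s : State n} {S : ℝ} {R : ℕ}
    (hP : Progress f h f' M L D χ ε lam₀ μ ν Nbar x₀ xs j s S R) :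
    (R : ℝ) + 1 ≤ (⌈2 * Real.log (lam₀ * constU M L D χ lam₀ ε Nbar / (Nbar * ε))⌉ : ℝ) := by
  have hA := nullConst_pos (D := D) (Nbar := Nbar) hM hL hχ₁ hε
  have hN : (0 : ℝ) < Nbar := by exact_mod_cast hNbar
  have hUA : lam₀ * constU M L D χ lam₀ ε Nbar / (Nbar * ε) =
      1 + lam₀ * nullConst M L D χ ε Nbar / (Nbar * ε) := by
    change lam₀ * (nullConst M L D χ ε Nbar + Nbar * ε / lam₀) / (Nbar * ε) = _
    field_simp; ring
  have key : (R : ℝ) < 2 * Real.log (lam₀ * constU M L D χ lam₀ ε Nbar / (Nbar * ε)) := by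
    rw [hUA]
    have h0 : 0 < lam₀ * nullConst M L D χ ε Nbar / (Nbar * ε) := by positivity
    rcases R with _ | R
    · have := Real.log_pos (show 1 < 1 + lam₀ * nullConst M L D χ ε Nbar / (Nbar * ε) by linarith)
      push_cast
      linarith
    · have h1 := hP.reset (Nat.succ_ne_zero R)
      rw [hP.stepsize_eq, pow_succ, le_div_iff₀ hε] at h1
      have e : 2 * (lam₀ / (2 ^ R * 2)) = lam₀ / 2 ^ R := by field_simp
      rw [e, div_mul_eq_mul_div, le_div_iff₀ (by positivity)] at h1
      have h2 : (2 : ℝ) ^ R ≤ lam₀ * nullConst M L D χ ε Nbar / (Nbar * ε) := by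
        rw [le_div_iff₀ (by positivity)]
        have : 0 ≤ ε * (2 : ℝ) ^ R := by positivity
        linarith
      have h3 := (exp_half_lt R).trans_le (add_le_add_right h2 1)
      rw [← Real.lt_log_iff_exp_lt (by linarith)] at h3
      push_cast
      linarith
  have h1 : (R : ℝ) < (⌈2 * Real.log (lam₀ * constU M L D χ lam₀ ε Nbar / (Nbar * ε))⌉ : ℝ) :=
    key.trans_le (Int.le_ceil _)
  have h2 : (R : ℤ) < ⌈2 * Real.log (lam₀ * constU M L D χ lam₀ ε Nbar / (Nbar * ε))⌉ := by
    exact_mod_cast h1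
  exact_mod_cast Int.add_one_le_iff.2 h2

/-- The number of iterations in completed serious cycles. -/
theorem Progress.serious_le {U : ℝ} (hU : constU M L D χ lam₀ ε Nbar = U) (hU0 : 0 < U)
    (hχ₀ : 0 ≤ χ) (hε : 0 < ε) (hNbar : 1 ≤ Nbar)
    (hν₀ : 0 ≤ ν) (hνμ : ν ≤ μ) {xs : E n} {j : ℕ} {s : State n} {S : ℝ} {R : ℕ}
    (hP : Progress f h f' M L D χ ε lam₀ μ ν Nbar x₀ xs j s S R) :
    (S : EReal) ≤ min
      (if μ = 0 then ⊤ else strongFactor χ ε μ ν U Nbar *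
        ((Real.log (1 + μ * ‖xs - x₀‖ ^ 2 / ε) : ℝ) : EReal))
      ((‖xs - x₀‖ ^ 2 * U / ε ^ 2 : ℝ) : EReal) := by
  have hN : (0 : ℝ) < Nbar := by exact_mod_cast hNbar
  have hdist : S ≤ ‖xs - x₀‖ ^ 2 * U / ε ^ 2 := by
    have h1 := hP.dist
    rw [hU] at h1
    have h2 : S * (ε ^ 2 / U) ≤ ‖xs - x₀‖ ^ 2 := by
      have := sq_nonneg ‖xs - s.center‖
      linarith
    rw [← mul_div_assoc, div_le_iff₀ hU0] at h2
    rwa [le_div_iff₀ (by positivity)]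
  have hrate : ∀ m w, IsRate χ ε μ ν U Nbar m w → m ≤ μ → 0 < w →
      S ≤ w * Real.log (1 + μ * ‖xs - x₀‖ ^ 2 / ε) := by
    intro m w hr hmμ hw
    have hm := hr.1
    rw [← hU] at hr
    have h1 := hP.rate m w hr
    have h2 : Real.log (ε / m) ≤ Real.log (‖xs - s.center‖ ^ 2 + ε / m) :=
      Real.log_le_log (by positivity) (by have := sq_nonneg ‖xs - s.center‖; linarith)
    have h3 : Real.log (‖xs - x₀‖ ^ 2 + ε / m) =
        Real.log (1 + m * ‖xs - x₀‖ ^ 2 / ε) + Real.log (ε / m) := by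
      rw [← Real.log_mul (by positivity) (by positivity)]
      congr 1
      field_simp; ring
    have h4 : Real.log (1 + m * ‖xs - x₀‖ ^ 2 / ε) ≤ Real.log (1 + μ * ‖xs - x₀‖ ^ 2 / ε) :=
      Real.log_le_log (by positivity) (by gcongr)
    have h5 : S / w ≤ Real.log (1 + μ * ‖xs - x₀‖ ^ 2 / ε) := by linarith
    rw [div_le_iff₀ hw] at h5
    linarith
  refine le_min ?_ (by exact_mod_cast hdist)
  split_ifs with hμ0
  · exact le_top
  have hμ : 0 < μ := lt_of_le_of_ne (hν₀.trans hνμ) (Ne.symm hμ0)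
  rcases (norm_nonneg (xs - x₀)).eq_or_lt with hz | hpos
  · rw [← hz] at hdist ⊢
    norm_num at hdist ⊢
    exact_mod_cast hdist
  · have hlog : 0 < Real.log (1 + μ * ‖xs - x₀‖ ^ 2 / ε) := by
      apply Real.log_pos
      have : 0 < μ * ‖xs - x₀‖ ^ 2 / ε := by positivity
      linarith
    unfold strongFactor
    rcases min_choice (if χ = 0 then ⊤ else ((1 / χ * (Nbar + U / (μ * ε)) : ℝ) : EReal))
      (if ν = 0 then ⊤ else ((Nbar + U / (ν * ε) : ℝ) : EReal)) with hmin | hmin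
    · rw [hmin]
      split_ifs with h0
      · rw [EReal.top_mul_coe_of_pos hlog]; exact le_top
      · have hχ : 0 < χ := lt_of_le_of_ne hχ₀ (Ne.symm h0)
        exact_mod_cast hrate μ _ ⟨hμ, Or.inl ⟨hχ, rfl, rfl⟩⟩ le_rfl (by positivity)
    · rw [hmin]
      split_ifs with h0
      · rw [EReal.top_mul_coe_of_pos hlog]; exact le_top
      · have hν : 0 < ν := lt_of_le_of_ne hν₀ (Ne.symm h0)
        exact_mod_cast hrate ν _ ⟨hν, Or.inr ⟨rfl, rfl⟩⟩ hνμ (by positivity)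

end Execution

end UniversalBundle

theorem theorem2p4 {n : ℕ}
    (f h : UniversalBundle.E n → EReal) (f' : UniversalBundle.E n → UniversalBundle.E n)
    (M L D : ℝ) (hM : 0 < M) (hL : 0 ≤ L)
    (hprob : UniversalBundle.IsHybridProblem f h f' M L)
    (hdom : (UniversalBundle.effDom h).Nontrivial)
    (hD : ∀ x ∈ UniversalBundle.effDom h, ∀ y ∈ UniversalBundle.effDom h, ‖x - y‖ ≤ D)
    (x₀ : UniversalBundle.E n) (hx₀ : x₀ ∈ UniversalBundle.effDom h)
    (χ lam₀ ε : ℝ) (hχ₀ : 0 ≤ χ) (hχ₁ : χ < 1) (hlam₀ : 0 < lam₀) (hε : 0 < ε)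
    (Nbar : ℕ) (hNbar : 1 ≤ Nbar)
    (J : ℕ) (s : ℕ → UniversalBundle.State n) (x : ℕ → UniversalBundle.E n)
    (hexec : UniversalBundle.IsExecution f h f' x₀ χ lam₀ ε Nbar J s x) :
    ((J : ℝ) : EReal) ≤
      UniversalBundle.iterationBound χ lam₀ ε
        (UniversalBundle.intrinsicConvexity (UniversalBundle.objective f h))
        (UniversalBundle.intrinsicConvexity h)
        (Metric.infDist x₀ (UniversalBundle.minimizers (UniversalBundle.objective f h)))
        (UniversalBundle.constU M L D χ lam₀ ε Nbar) Nbar := by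
  open UniversalBundle in
  obtain ⟨xs, hxs, hdist⟩ := hprob.isClosed_minimizers.exists_infDist_eq_dist hprob.exists_min x₀
  have hxsh := hprob.mem_effDom_of_minimizer hxs hx₀
  obtain ⟨hν₀, hνμ, hν, hμ⟩ := hprob.moduli hdom
  obtain ⟨S, R, hS, hP⟩ := hexec.exists_progress hprob hM hL hD hx₀ hχ₀ hχ₁ hlam₀ hε hNbar hν₀ hν hμ
    hxs hxsh (J - 1) (by omega)
  have hU : 0 < constU M L D χ lam₀ ε Nbar := by
    have hA := nullConst_pos (D := D) (Nbar := Nbar) hM hL hχ₁ hε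
    change 0 < nullConst M L D χ ε Nbar + Nbar * ε / lam₀
    positivity
  have hser := hP.serious_le rfl hU hχ₀ hε hNbar hν₀ hνμ
  have hres := hP.resets_le hM hL hχ₁ hlam₀ hε hNbar
  rw [hdist, dist_comm, dist_eq_norm]
  have hJ : (J : ℝ) ≤ S + Nbar *
      (⌈2 * Real.log (lam₀ * constU M L D χ lam₀ ε Nbar / (Nbar * ε))⌉ : ℝ) := by
    have h1 := hP.count_eq
    have h2 : ((s (J - 1 + 1)).count : ℝ) + 1 ≤ Nbar := by exact_mod_cast hP.count_lt
    have h3 : (J : ℝ) ≤ ((J - 1 + 1 : ℕ) : ℝ) := by exact_mod_cast (by omega)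
    have h4 := mul_le_mul_of_nonneg_left hres (Nat.cast_nonneg (α := ℝ) Nbar)
    linarith
  unfold iterationBound
  calc ((J : ℝ) : EReal) ≤ ((S + Nbar *
      (⌈2 * Real.log (lam₀ * constU M L D χ lam₀ ε Nbar / (Nbar * ε))⌉ : ℝ) : ℝ) : EReal) := by
        exact_mod_cast hJ
    _ = (S : EReal) + ((Nbar *
      (⌈2 * Real.log (lam₀ * constU M L D χ lam₀ ε Nbar / (Nbar * ε))⌉ : ℝ) : ℝ) : EReal) :=
        EReal.coe_add _ _
    _ ≤ _ := add_le_add_left hser _
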